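/- Let $M$ be a finitely generated, left cancellative monoid of bounded indegree which is strongly hyperbolic. Then the $\mathcal{L}$-order and the $\mathcal{R}$-order of $M$ are both in $\mathcal{NP}$; that is, for every finite alphabet $A$ with a map $f\colon A\to M$ whose image generates $M$ (extended to words $A^*\to M$), the languages $\{u\#v : u,v\in A^*,\ Mf(u)\subseteq Mf(v)\}$ and $\{u\#v : u,v\in A^*,\ f(u)M\subseteq f(v)M\}$ over $A\sqcup\{\#\}$ are in $\mathcal{NP}$. Here $M$ has bounded indegree if, for some finite generating set $S$ (equivalently, for every one) and some $\alpha\in\mathbb{N}$, there are no $a\in S$ and distinct $x_0,\dots,x_\alpha\in M$ with $x_0a=\dots=x_\alpha a$. For a finite generating set $S$, the right Cayley graph is the directed graph with vertex set $M$ and edges $m\to ms$ ($m\in M$, $s\in S$); $d(x,y)\in\mathbb{N}\cup\{\infty\}$ denotes the length of a shortest directed path from $x$ to $y$, and a geodesic is a directed path whose length is the distance from its start to its end. A geodesic triangle $(p,q,r)$ consists of three geodesics such that $q$ starts where $p$ ends, $r$ starts where $p$ starts and $r$ ends where $q$ ends. It is $\delta$-thin if every vertex $v$ of $r$ satisfies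 $d(a,v)\le\delta$ for some vertex $a$ of $p$ or $d(v,b)\le\delta$ for some vertex $b$ of $q$; every vertex $v$ of $p$ satisfies $d(a,v)\le\delta$ for some $a$ on $r$ or $d(v,b)\le\delta$ for some $b$ on $q$; and every vertex $v$ of $q$ satisfies $d(a,v)\le\delta$ for some $a$ on $p$ or $d(v,b)\le\delta$ for some $b$ on $r$. The monoid $M$ is strongly hyperbolic if there are a finite generating set $S$ and a real $\delta\ge 0$ such that all geodesic triangles of the right Cayley graph with respect to $S$ are $\delta$-thin. A language $L$ over a finite alphabet is in $\mathcal{NP}$ if there are a nondeterministic Turing machine and a polynomial $P$ such that the machine accepts exactly the words of $L$, and every $x\in L$ has an accepting computation of at most $P(|x|)$ steps. -/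

import Mathlib

namespace HypMonoid

/-! Directed graphs as semimetric spaces. Multiplicities of edges play no role for the distance
or for paths (which are sequences of vertices), so `Digraph` is used. -/

section Graph

variable {V : Type*}

/-- A directed path `[x₀, …, xₙ]` (`n ≥ 0`) in `G`; its number `n` of edges is `p.length`,
its start is `p.head` and its end is `p.last`. -/
abbrev DiPath (G : Digraph V) : Type _ := RelSeries {e : V × V | G.Adj e.1 e.2}

/-- The length of a shortest directed path from `x` to `y`, and `⊤` if there is none. -/
noncomputable def dist (G : Digraph V) (x y : V) : ℕ∞ :=
  ⨅ p : {p : DiPath G // p.head = x ∧ p.last = y}, (p.1.length : ℕ∞)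

/-- The out-ball of radius `r` based at `x`. -/
def outBall (G : Digraph V) (r : NNReal) (x : V) : Set V :=
  {y | ((dist G x y : ℕ∞) : ENNReal) ≤ r}

/-- The in-ball of radius `r` based at `x`. -/
def inBall (G : Digraph V) (r : NNReal) (x : V) : Set V :=
  {y | ((dist G y x : ℕ∞) : ENNReal) ≤ r}

/-- A path is a geodesic if its length is the distance from its start to its end. -/
def IsGeodesic {G : Digraph V} (p : DiPath G) : Prop :=
  (p.length : ℕ∞) = dist G p.head p.last

/-- `(p, q, r)` is a geodesic triangle: three geodesics such that `p` and `q` are composable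
and the composite of `p` and `q` is parallel to `r`. -/
structure IsGeodesicTriangle {G : Digraph V} (p q r : DiPath G) : Prop where
  geodesic_left : IsGeodesic p
  geodesic_right : IsGeodesic q
  geodesic_hyp : IsGeodesic r
  composable : p.last = q.head
  head_eq : p.head = r.head
  last_eq : q.last = r.last

/-- Every vertex of the side `x` lies in the out-ball of radius `δ` around some vertex of the side
`y`, or in the in-ball of radius `δ` around some vertex of the side `z`. -/
def SideThin {G : Digraph V} (δ : NNReal) (x y z : DiPath G) : Prop :=
  ∀ v ∈ x, (∃ a ∈ y, v ∈ outBall G δ a) ∨ (∃ b ∈ z, v ∈ inBall G δ b)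

/-- The directed triangle `(p, q, r)` is `δ`-thin: each side is covered by the out-balls around the
side meeting its start and the in-balls around the side meeting its end. -/
def IsThin {G : Digraph V} (δ : NNReal) (p q r : DiPath G) : Prop :=
  SideThin δ r p q ∧ SideThin δ p r q ∧ SideThin δ q p r

/-- All geodesic triangles of `G` are `δ`-thin. -/
def StronglyDeltaHyperbolic (G : Digraph V) (δ : NNReal) : Prop :=
  ∀ p q r : DiPath G, IsGeodesicTriangle p q r → IsThin δ p q r

end Graph

section Monoid

variable (M : Type*) [Monoid M]

/-- The finite set `S` generates the monoid `M`. -/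
def Generates {M : Type*} [Monoid M] (S : Finset M) : Prop :=
  Submonoid.closure (S : Set M) = ⊤

/-- The right Cayley graph of `M` with respect to `S`: an edge from `m` to `m * s` for `s ∈ S`. -/
def rightCayley {M : Type*} [Monoid M] (S : Finset M) : Digraph M where
  Adj m n := ∃ s ∈ S, m * s = n

/-- The right Cayley graph with respect to some finite generating set is strongly
`δ`-hyperbolic for some `δ ≥ 0`. -/
def StronglyHyperbolic : Prop :=
  ∃ S : Finset M, Generates S ∧ ∃ δ : NNReal, StronglyDeltaHyperbolic (rightCayley S) δ

/-- With respect to some finite generating set, the right indegree is bounded by some natural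
number `α`: no generator `a` admits `α + 1` distinct elements `x₀, …, x_α` with
`x₀ a = ⋯ = x_α a`. -/
def BoundedIndegree : Prop :=
  ∃ S : Finset M, Generates S ∧ ∃ α : ℕ, ∀ a ∈ S,
    ¬ ∃ x : Fin (α + 1) → M, Function.Injective x ∧ ∀ i j, x i * a = x j * a

/-- The `R`-order: `a M ⊆ b M`. -/
def ROrder {M : Type*} [Monoid M] (a b : M) : Prop :=
  Set.range (fun m : M => a * m) ⊆ Set.range (fun m : M => b * m)

/-- The `L`-order: `M a ⊆ M b`. -/
def LOrder {M : Type*} [Monoid M] (a b : M) : Prop :=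
  Set.range (fun m : M => m * a) ⊆ Set.range (fun m : M => m * b)

end Monoid

section Machines

/-- A nondeterministic Turing machine with input alphabet `A` and `tapes + 1` two-way infinite
tapes. Tape symbols are the input letters, finitely many work symbols, and the blank `none`. In
one step the machine reads the scanned symbols, and chooses an element of `trans`: a new state and,
for each tape, a symbol to be written followed by a move of the head (`none`: no move). -/
structure NTM (A : Type*) where
  tapes : ℕ
  Work : Type
  finiteWork : Finite Work
  State : Type
  finiteState : Finite State
  start : State
  accept : State
  trans : State → (Fin (tapes + 1) → Option (A ⊕ Work)) →
    Set (State × (Fin (tapes + 1) → Option (A ⊕ Work) × Option Turing.Dir))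

namespace NTM

variable {A : Type*}

/-- Configurations: a state, and for each tape its contents together with the head position. -/
structure Cfg (N : NTM A) where
  state : N.State
  tape : Fin (N.tapes + 1) → Turing.Tape (Option (A ⊕ N.Work))

/-- The initial configuration: the input is on tape `0`, its first letter being scanned, and all
the other tapes are blank. -/
def init (N : NTM A) (x : List A) : N.Cfg where
  state := N.start
  tape := fun i => if i = 0 then Turing.Tape.mk₁ (x.map fun a => some (Sum.inl a))
    else Turing.Tape.mk₁ []

/-- Write a symbol, then move the head. -/
def act {Γ : Type*} [Inhabited Γ] (s : Γ × Option Turing.Dir) (T : Turing.Tape Γ) :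
    Turing.Tape Γ :=
  match s.2 with
  | none => T.write s.1
  | some d => (T.write s.1).move d

/-- `c'` is a possible successor of the configuration `c`. -/
def Step (N : NTM A) (c c' : N.Cfg) : Prop :=
  ∃ t ∈ N.trans c.state (fun i => (c.tape i).head),
    c'.state = t.1 ∧ c'.tape = fun i => act (t.2 i) (c.tape i)

/-- There is a computation of exactly `n` steps from the first to the second configuration. -/
inductive Reaches (N : NTM A) : ℕ → N.Cfg → N.Cfg → Prop
  | refl (c : N.Cfg) : Reaches N 0 c c
  | step {n : ℕ} {c d e : N.Cfg} : N.Step c d → Reaches N n d e → Reaches N (n + 1) c e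

/-- Some computation on input `x` is in the accepting state after `n` steps. -/
def AcceptsIn (N : NTM A) (x : List A) (n : ℕ) : Prop :=
  ∃ c : N.Cfg, N.Reaches n (N.init x) c ∧ c.state = N.accept

end NTM

/-- The class NP of languages over the finite alphabet `A`: some nondeterministic Turing
machine accepts exactly the words of `L`, and each word of `L` has an accepting computation whose
number of steps is bounded by a polynomial in the length of the word. -/
def InNP {A : Type*} [Finite A] (L : Language A) : Prop :=
  ∃ (N : NTM A) (p : Polynomial ℕ),
    (∀ x n, N.AcceptsIn x n → x ∈ L) ∧
    (∀ x ∈ L, ∃ n ≤ p.eval x.length, N.AcceptsIn x n)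

end Machines

/-- The decision problem for a relation `rel` on `M`, where elements of `M` are given by words over
an alphabet `A` whose letters represent elements of `M` via `f`: the language of all `u # v`, with
`u` and `v` words over `A` whose values in `M` are related. The separator `#` is `none`. -/
def relLanguage {A M : Type*} [Monoid M] (f : A → M) (rel : M → M → Prop) : Language (Option A) :=
  {x | ∃ u v : List A, x = u.map some ++ none :: v.map some ∧
    rel (u.map f).prod (v.map f).prod}

end HypMonoid

/-! The orders say that `u` and `y v` (`L`-order), or `u` and `v z` (`R`-order), have equal values
for some `y` or `z`. The proof rests on two facts: a witness can be chosen of length linear in `|u|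
+ |v|`, and equality of values has a certificate of quadratic size that a machine with finite memory
and two stacks can guess and check.

Short witnesses: in a thin geodesic triangle, each side is covered by out-balls and in-balls of a
fixed radius around the other two. Out-balls are finite, of bounded size by left cancellation and
finite generation, and in-balls are so by bounded indegree. The vertices of a geodesic are distinct,
so counting bounds each of the first two sides linearly by the other sides (`exists_linearSides`).
Apply this to geodesics for the witness and for the values of `u` and `v`.

Certificates: a buffer holding an element of a fixed ball sits between two stacks and exchanges
letters with them, the product of left stack, buffer and right stack being preserved. If `p` and `r`
are geodesics with `p a = r` and `a` short, then every vertex of `r` is a bounded path away from a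
vertex of `p` (`ThinWords.fellow`). Walking backwards along `r` while carrying this path in the
buffer rewrites `p a` into `r` in linearly many moves (`moves_triangle`). Doing this for each letter
brings a word to a geodesic normal form in quadratically many moves. Moves are reversible, so two
words of equal value are joined through their common normal form (`moves_of_prod_eq`).

The machine guesses moves on `u`, then compares the resulting word with `v`, leaving out the factor
`y` or `z`. Soundness is invariance of the product (`BufferInv.step`); completeness simulates the
moves (`bufferMachine_complete`). -/

namespace HypMonoid

/-! ### Balls and geodesic words over a finite generating set. -/

section Words

variable {M : Type*} [Monoid M] {S : Finset M}

/-- The elements represented by words of length at most `n` over `S`. -/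
def wordBall (S : Finset M) (n : ℕ) : Set M :=
  {m | ∃ w : List M, (∀ s ∈ w, s ∈ S) ∧ w.length ≤ n ∧ w.prod = m}

/-- A word over `S` of minimal length among the words representing the same element. -/
def IsGeodesicWord (S : Finset M) (w : List M) : Prop :=
  (∀ s ∈ w, s ∈ S) ∧ ∀ w' : List M, (∀ s ∈ w', s ∈ S) → w'.prod = w.prod → w.length ≤ w'.length

theorem wordBall_mono {m n : ℕ} (h : m ≤ n) : wordBall S m ⊆ wordBall S n := by
  rintro _ ⟨w, hw, hl, rfl⟩
  exact ⟨w, hw, hl.trans h, rfl⟩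

theorem one_mem_wordBall (n : ℕ) : (1 : M) ∈ wordBall S n :=
  ⟨[], by simp, by simp, by simp⟩

theorem prod_mem_wordBall {w : List M} (hw : ∀ s ∈ w, s ∈ S) {n : ℕ} (hn : w.length ≤ n) :
    w.prod ∈ wordBall S n :=
  ⟨w, hw, hn, rfl⟩

theorem mem_wordBall_one {s : M} (hs : s ∈ S) : s ∈ wordBall S 1 :=
  ⟨[s], by simpa using hs, by simp, by simp⟩

theorem mul_mem_wordBall {a b : M} {m n : ℕ} (ha : a ∈ wordBall S m) (hb : b ∈ wordBall S n) :
    a * b ∈ wordBall S (m + n) := by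
  obtain ⟨u, hu, hul, rfl⟩ := ha
  obtain ⟨v, hv, hvl, rfl⟩ := hb
  refine ⟨u ++ v, ?_, by simp; omega, by simp⟩
  intro s hs
  rcases List.mem_append.1 hs with h | h
  · exact hu s h
  · exact hv s h

theorem finite_wordBall (S : Finset M) (n : ℕ) : (wordBall S n).Finite := by
  induction n with
  | zero =>
    refine (Set.finite_singleton (1 : M)).subset ?_
    rintro _ ⟨w, -, hl, rfl⟩
    simp [List.length_eq_zero_iff.1 (Nat.le_zero.1 hl)]
  | succ n ih =>
    refine ((S.finite_toSet.image2 (· * ·) ih).union (Set.finite_singleton (1 : M))).subset ?_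
    rintro _ ⟨w, hw, hl, rfl⟩
    cases w with
    | nil => simp
    | cons s w =>
      left
      refine ⟨s, by exact_mod_cast hw s (by simp), w.prod, ⟨w, fun t ht => hw t (by simp [ht]), ?_, rfl⟩,
        by simp⟩
      simpa using hl

theorem exists_word (hS : Generates S) (m : M) : ∃ w : List M, (∀ s ∈ w, s ∈ S) ∧ w.prod = m := by
  have hm : m ∈ Submonoid.closure (S : Set M) := by
    rw [show Submonoid.closure (S : Set M) = ⊤ from hS]; trivial
  obtain ⟨w, hw, h⟩ := Submonoid.exists_list_of_mem_closure hm
  exact ⟨w, fun s hs => by exact_mod_cast hw s hs, h⟩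

theorem exists_geodesicWord (hS : Generates S) (m : M) :
    ∃ w : List M, IsGeodesicWord S w ∧ w.prod = m := by
  classical
  have h : ∃ n, ∃ w : List M, (∀ s ∈ w, s ∈ S) ∧ w.prod = m ∧ w.length = n := by
    obtain ⟨w, hw, h⟩ := exists_word hS m
    exact ⟨_, w, hw, h, rfl⟩
  obtain ⟨w, hw, hm, hl⟩ := Nat.find_spec h
  refine ⟨w, ⟨hw, fun w' hw' h' => ?_⟩, hm⟩
  rw [hl]
  exact Nat.find_min' h ⟨w', hw', h'.trans hm, rfl⟩

theorem exists_wordBall (hS : Generates S) {X : Set M} (hX : X.Finite) :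
    ∃ n, X ⊆ wordBall S n := by
  induction X, hX using Set.Finite.induction_on with
  | empty => exact ⟨0, Set.empty_subset _⟩
  | @insert a X _ _ ih =>
    obtain ⟨n, hn⟩ := ih
    obtain ⟨w, hw, rfl⟩ := exists_word hS a
    refine ⟨max w.length n, Set.insert_subset ⟨w, hw, le_max_left _ _, rfl⟩ ?_⟩
    exact hn.trans (wordBall_mono (le_max_right _ _))

theorem IsGeodesicWord.length_le {w : List M} (hw : IsGeodesicWord S w) {n : ℕ}
    (h : w.prod ∈ wordBall S n) : w.length ≤ n := by
  obtain ⟨w', hw', hl, h'⟩ := h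
  exact (hw.2 w' hw' h').trans hl

theorem IsGeodesicWord.left {a b : List M} (h : IsGeodesicWord S (a ++ b)) :
    IsGeodesicWord S a := by
  refine ⟨fun s hs => h.1 s (by simp [hs]), fun w hw hp => ?_⟩
  have := h.2 (w ++ b) (fun s hs => (List.mem_append.1 hs).elim (hw s) fun hs => h.1 s (by simp [hs]))
    (by simp [hp])
  simpa using this

theorem IsGeodesicWord.right {a b : List M} (h : IsGeodesicWord S (a ++ b)) :
    IsGeodesicWord S b := by
  refine ⟨fun s hs => h.1 s (by simp [hs]), fun w hw hp => ?_⟩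
  have := h.2 (a ++ w) (fun s hs => (List.mem_append.1 hs).elim (fun hs => h.1 s (by simp [hs])) (hw s))
    (by simp [hp])
  simpa using this

theorem IsGeodesicWord.take {w : List M} (h : IsGeodesicWord S w) (n : ℕ) :
    IsGeodesicWord S (w.take n) := by
  rw [← List.take_append_drop n w] at h
  exact h.left

theorem IsGeodesicWord.drop {w : List M} (h : IsGeodesicWord S w) (n : ℕ) :
    IsGeodesicWord S (w.drop n) := by
  rw [← List.take_append_drop n w] at h
  exact h.right

theorem IsGeodesicWord.take_prod_ne {w : List M} (h : IsGeodesicWord S w) {i j : ℕ} (hij : i < j)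
    (hj : j ≤ w.length) : (w.take i).prod ≠ (w.take j).prod := by
  intro he
  have h' := (h.take j).2 (w.take i) (h.take i).1 he
  simp at h'
  omega

theorem prod_take_mul_prod_drop_take (w : List M) {i j : ℕ} (hij : i ≤ j) :
    (w.take i).prod * ((w.drop i).take (j - i)).prod = (w.take j).prod := by
  rw [← List.prod_append, ← List.take_add, Nat.add_sub_cancel' hij]

end Words

/-! ### Translation between words and paths in the Cayley graph. -/

section Paths

variable {M : Type*} [Monoid M] {S : Finset M}

/-- The path in the right Cayley graph that starts at `x` and is labelled by the word `w`. -/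
def wordPath (x : M) (w : List M) (hw : ∀ s ∈ w, s ∈ S) : DiPath (rightCayley S) where
  length := w.length
  toFun i := x * (w.take i).prod
  step i := ⟨w[i.1], hw _ (List.getElem_mem _), by
    change x * (w.take i.1).prod * w[i.1] = x * (w.take (i.1 + 1)).prod
    rw [mul_assoc, List.prod_take_succ]⟩

theorem wordPath_head (x : M) (w : List M) (hw : ∀ s ∈ w, s ∈ S) :
    (wordPath x w hw).head = x := by
  simp [RelSeries.head, wordPath]

theorem wordPath_last (x : M) (w : List M) (hw : ∀ s ∈ w, s ∈ S) :
    (wordPath x w hw).last = x * w.prod := by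
  simp [RelSeries.last, wordPath]

theorem mem_wordPath {x v : M} {w : List M} {hw : ∀ s ∈ w, s ∈ S} :
    v ∈ wordPath x w hw ↔ ∃ i ≤ w.length, v = x * (w.take i).prod := by
  constructor
  · rintro ⟨i, rfl⟩
    exact ⟨i.1, Nat.lt_succ_iff.1 i.2, rfl⟩
  · rintro ⟨i, hi, rfl⟩
    exact ⟨⟨i, Nat.lt_succ_of_le hi⟩, rfl⟩

theorem exists_word_of_path (p : DiPath (rightCayley S)) :
    ∃ w : List M, (∀ s ∈ w, s ∈ S) ∧ w.length = p.length ∧ p.head * w.prod = p.last := by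
  have key : ∀ i : ℕ, ∀ hi : i < p.length + 1,
      ∃ w : List M, (∀ s ∈ w, s ∈ S) ∧ w.length = i ∧ p.head * w.prod = p ⟨i, hi⟩ := by
    intro i
    induction i with
    | zero => exact fun _ => ⟨[], by simp, rfl, by simp [RelSeries.head]⟩
    | succ i ih =>
      intro hi
      obtain ⟨w, hw, hl, hp⟩ := ih (by omega)
      obtain ⟨s, hs, h⟩ := p.step ⟨i, by omega⟩
      refine ⟨w ++ [s], ?_, by simp [hl], ?_⟩
      · intro t ht
        rcases List.mem_append.1 ht with ht | ht
        · exact hw t ht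
        · rw [List.mem_singleton.1 ht]; exact hs
      · rw [List.prod_append, ← mul_assoc, hp, List.prod_singleton]
        exact h
  exact key p.length (Nat.lt_succ_self _)

/-- A parallel path has a label `w'` with `x * w'.prod = x * w.prod`. Left cancellation removes `x`,
so `w'` competes with `w` as a word for the same element. Thus geodesic words label geodesics from
any starting vertex. -/
theorem isGeodesic_wordPath [IsLeftCancelMul M] (x : M) {w : List M} (hw : IsGeodesicWord S w) :
    IsGeodesic (wordPath x w hw.1) := by
  unfold IsGeodesic dist
  apply le_antisymm
  · refine le_iInf ?_
    rintro ⟨p, hh, hl⟩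
    obtain ⟨w', hw', hl', hp⟩ := exists_word_of_path p
    rw [hh, hl, wordPath_head, wordPath_last] at hp
    have := hw.2 w' hw' (mul_left_cancel hp)
    rw [hl'] at this
    exact_mod_cast this
  · exact iInf_le_of_le ⟨wordPath x w hw.1, rfl, rfl⟩ le_rfl

theorem exists_mem_wordBall_of_dist_le {δ : NNReal} {x y : M}
    (h : ((dist (rightCayley S) x y : ℕ∞) : ENNReal) ≤ δ) :
    ∃ m ∈ wordBall S ⌊δ⌋₊, x * m = y := by
  have hne : Nonempty {p : DiPath (rightCayley S) // p.head = x ∧ p.last = y} := by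
    by_contra hn
    rw [not_nonempty_iff] at hn
    simp [dist] at h
  -- The distance is finite, so some path exists and the infimum is attained. Lengths are integers,
  -- hence `⌊δ⌋₊` bounds them as well as `δ` does.
  obtain ⟨⟨p, hx, hy⟩, hp⟩ := ENat.exists_eq_iInf
    (fun p : {p : DiPath (rightCayley S) // p.head = x ∧ p.last = y} => (p.1.length : ℕ∞))
  obtain ⟨w, hw, hl, hm⟩ := exists_word_of_path p
  refine ⟨w.prod, ⟨w, hw, ?_, rfl⟩, by rw [← hx, ← hy, hm]⟩
  rw [dist, ← hp] at h
  rw [hl]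
  refine Nat.le_floor ?_
  simp only [ENat.toENNReal_coe] at h
  exact_mod_cast h

end Paths

/-! ### Thinness of triangles in terms of words. -/

section Thin

variable {M : Type*} [Monoid M] {S : Finset M}

/-- The vertices `x * u₁ ⋯ uᵢ` are covered by the out-balls around the vertices
`y * v₁ ⋯ vⱼ` and the in-balls around the vertices `z * w₁ ⋯ wⱼ`. -/
def WordSideThin (S : Finset M) (D : ℕ) (x : M) (u : List M) (y : M) (v : List M)
    (z : M) (w : List M) : Prop :=
  ∀ i ≤ u.length,
    (∃ j ≤ v.length, ∃ m ∈ wordBall S D, y * (v.take j).prod * m = x * (u.take i).prod) ∨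
    (∃ j ≤ w.length, ∃ m ∈ wordBall S D, x * (u.take i).prod * m = z * (w.take j).prod)

/-- Geodesic triangles starting at `1`, in terms of the words labelling their sides, are
`D`-thin. -/
def ThinWords (S : Finset M) (D : ℕ) : Prop :=
  ∀ p q r : List M, IsGeodesicWord S p → IsGeodesicWord S q → IsGeodesicWord S r →
    p.prod * q.prod = r.prod →
    WordSideThin S D 1 r 1 p p.prod q ∧ WordSideThin S D 1 p 1 r p.prod q ∧
      WordSideThin S D p.prod q 1 p 1 r

theorem wordSideThin_of_sideThin {δ : NNReal} {x y z : M} {u v w : List M}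
    {hu : ∀ s ∈ u, s ∈ S} {hv : ∀ s ∈ v, s ∈ S} {hw : ∀ s ∈ w, s ∈ S}
    (h : SideThin δ (wordPath x u hu) (wordPath y v hv) (wordPath z w hw)) :
    WordSideThin S ⌊δ⌋₊ x u y v z w := by
  intro i hi
  rcases h _ (mem_wordPath.2 ⟨i, hi, rfl⟩) with ⟨a, ha, hd⟩ | ⟨b, hb, hd⟩
  · obtain ⟨j, hj, rfl⟩ := mem_wordPath.1 ha
    exact Or.inl ⟨j, hj, exists_mem_wordBall_of_dist_le hd⟩
  · obtain ⟨j, hj, rfl⟩ := mem_wordPath.1 hb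
    exact Or.inr ⟨j, hj, exists_mem_wordBall_of_dist_le hd⟩

theorem thinWords_of_hyperbolic [IsLeftCancelMul M] {δ : NNReal}
    (h : StronglyDeltaHyperbolic (rightCayley S) δ) : ThinWords S ⌊δ⌋₊ := by
  intro p q r hp hq hr he
  obtain ⟨h1, h2, h3⟩ := h (wordPath 1 p hp.1) (wordPath p.prod q hq.1) (wordPath 1 r hr.1)
    ⟨isGeodesic_wordPath _ hp, isGeodesic_wordPath _ hq, isGeodesic_wordPath _ hr,
      by simp [wordPath_head, wordPath_last], by simp [wordPath_head],
      by simp [wordPath_last, he]⟩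
  exact ⟨wordSideThin_of_sideThin h1, wordSideThin_of_sideThin h2, wordSideThin_of_sideThin h3⟩

end Thin

/-! ### Linear bounds on the sides of triangles. -/

section Fibres

theorem length_le_of_cover {α : Type*} {n a b C : ℕ} {v : ℕ → α} (hv : Set.InjOn v {i | i ≤ n})
    {X Y : ℕ → Finset α} (hX : ∀ j, (X j).card ≤ C) (hY : ∀ j, (Y j).card ≤ C)
    (h : ∀ i ≤ n, (∃ j ≤ a, v i ∈ X j) ∨ ∃ j ≤ b, v i ∈ Y j) :
    n + 1 ≤ C * (a + b + 2) := by
  classical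
  have h1 : (Finset.range (n + 1)).image v ⊆
      (Finset.range (a + 1)).biUnion X ∪ (Finset.range (b + 1)).biUnion Y := by
    intro x hx
    obtain ⟨i, hi, rfl⟩ := Finset.mem_image.1 hx
    rcases h i (Nat.lt_succ_iff.1 (Finset.mem_range.1 hi)) with ⟨j, hj, hm⟩ | ⟨j, hj, hm⟩
    · exact Finset.mem_union_left _ (Finset.mem_biUnion.2 ⟨j, by simp; omega, hm⟩)
    · exact Finset.mem_union_right _ (Finset.mem_biUnion.2 ⟨j, by simp; omega, hm⟩)
  have h2 := Finset.card_le_card h1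
  rw [Finset.card_image_of_injOn (fun i hi j hj hij => hv (by simp at hi; simp; omega)
    (by simp at hj; simp; omega) hij), Finset.card_range] at h2
  have h3 := Finset.card_union_le ((Finset.range (a + 1)).biUnion X)
    ((Finset.range (b + 1)).biUnion Y)
  have h4 := Finset.card_biUnion_le_card_mul (Finset.range (a + 1)) X C fun j _ => hX j
  have h5 := Finset.card_biUnion_le_card_mul (Finset.range (b + 1)) Y C fun j _ => hY j
  rw [Finset.card_range] at h4 h5
  calc n + 1 ≤ (a + 1) * C + (b + 1) * C := by omega
    _ = C * (a + b + 2) := by ring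

variable {M : Type*} [Monoid M] {S : Finset M}

/-- The generating set that witnesses bounded indegree need not be the one that witnesses
hyperbolicity. Bounding the fibres of right multiplication by every element makes the choice
irrelevant. -/
theorem exists_card_fibre_le (hdeg : BoundedIndegree M) (m : M) :
    ∃ N : ℕ, ∀ y : M, ∃ F : Finset M, F.card ≤ N ∧ ∀ x, x * m = y → x ∈ F := by
  classical
  obtain ⟨T, hT, α, hα⟩ := hdeg
  have hm : m ∈ Submonoid.closure (T : Set M) := by
    rw [show Submonoid.closure (T : Set M) = ⊤ from hT]; trivial
  induction hm using Submonoid.closure_induction with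
  | mem a ha =>
    refine ⟨α, fun y => ?_⟩
    have hno : ¬ ∃ F : Finset M, (F : Set M) ⊆ {x | x * a = y} ∧ F.card = α + 1 := by
      rintro ⟨F, hF, hc⟩
      refine hα a (by exact_mod_cast ha) ⟨fun i => (F.equivFinOfCardEq hc).symm i,
        Subtype.val_injective.comp (Equiv.injective _), fun i j => ?_⟩
      rw [show _ * a = y from hF (Subtype.prop _), show _ * a = y from hF (Subtype.prop _)]
    have hfin : {x | x * a = y}.Finite := by
      by_contra hinf
      obtain ⟨F, hF, hc⟩ := Set.Infinite.exists_subset_card_eq hinf (α + 1)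
      exact hno ⟨F, hF, hc⟩
    refine ⟨hfin.toFinset, ?_, fun x hx => by simpa using hx⟩
    by_contra hlt
    obtain ⟨F, hF, hc⟩ := Finset.exists_subset_card_eq (show α + 1 ≤ hfin.toFinset.card by omega)
    exact hno ⟨F, fun x hx => by simpa using hF hx, hc⟩
  | one => exact ⟨1, fun y => ⟨{y}, by simp, fun x hx => by simpa using hx⟩⟩
  | mul a b _ _ iha ihb =>
    obtain ⟨Na, ha⟩ := iha
    obtain ⟨Nb, hb⟩ := ihb
    choose F hFc hF using ha
    -- The fibre of `a * b` over `y` is the union of the fibres of `a` over the points of the fibre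
    -- of `b` over `y`.
    refine ⟨Nb * Na, fun y => ?_⟩
    obtain ⟨G, hGc, hG⟩ := hb y
    refine ⟨G.biUnion F, ?_, fun x hx => ?_⟩
    · exact (Finset.card_biUnion_le_card_mul _ _ _ fun z _ => hFc z).trans
        (Nat.mul_le_mul_right _ hGc)
    · exact Finset.mem_biUnion.2 ⟨x * a, hG _ (by rw [mul_assoc, hx]), hF _ _ rfl⟩

theorem exists_card_inBall_le (hdeg : BoundedIndegree M) {X : Set M} (hX : X.Finite) :
    ∃ N : ℕ, ∀ y : M, ∃ F : Finset M, F.card ≤ N ∧ ∀ x, ∀ m ∈ X, x * m = y → x ∈ F := by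
  classical
  choose N hN using exists_card_fibre_le hdeg
  choose F hFc hF using hN
  refine ⟨∑ m ∈ hX.toFinset, N m, fun y => ⟨hX.toFinset.biUnion fun m => F m y, ?_, ?_⟩⟩
  · exact Finset.card_biUnion_le.trans (Finset.sum_le_sum fun m _ => hFc m y)
  · exact fun x m hm hx => Finset.mem_biUnion.2 ⟨m, by simpa using hm, hF m y x hx⟩

/-- In geodesic triangles `(p, q, r)`, the lengths of `p` and of `q` are linearly bounded by
the lengths of the other two sides. -/
def LinearSides (S : Finset M) (C : ℕ) : Prop :=
  ∀ p q r : List M, IsGeodesicWord S p → IsGeodesicWord S q → IsGeodesicWord S r →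
    p.prod * q.prod = r.prod →
    p.length + 1 ≤ C * (q.length + r.length + 2) ∧ q.length + 1 ≤ C * (p.length + r.length + 2)

theorem IsGeodesicWord.injOn_take [IsLeftCancelMul M] {w : List M} (h : IsGeodesicWord S w)
    (x : M) : Set.InjOn (fun i => x * (w.take i).prod) {i | i ≤ w.length} := by
  intro i hi j hj hij
  have hij' := mul_left_cancel hij
  rcases lt_trichotomy i j with hlt | rfl | hlt
  · exact (h.take_prod_ne hlt hj hij').elim
  · rfl
  · exact (h.take_prod_ne hlt hi hij'.symm).elim

/-- Each of `p` and `q` is a set of distinct vertices covered by balls of bounded size around the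
vertices of the other two sides. The in-balls are where bounded indegree enters. The third side
needs no such argument, since a geodesic is at most as long as the composite of `p` and `q`. -/
theorem exists_linearSides [IsLeftCancelMul M] (hdeg : BoundedIndegree M) {D : ℕ}
    (hthin : ThinWords S D) : ∃ C, LinearSides S C := by
  classical
  obtain ⟨N, hN⟩ := exists_card_inBall_le hdeg (finite_wordBall S D)
  choose F hFc hF using hN
  let O : M → Finset M := fun x => (finite_wordBall S D).toFinset.image (x * ·)
  have hO : ∀ x, (O x).card ≤ (finite_wordBall S D).toFinset.card := fun x => Finset.card_image_le
  refine ⟨max N (finite_wordBall S D).toFinset.card, fun p q r hp hq hr he => ?_⟩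
  have key : ∀ {x y z : M} {u v w : List M}, IsGeodesicWord S u →
      WordSideThin S D x u y v z w →
      u.length + 1 ≤ max N (finite_wordBall S D).toFinset.card * (v.length + w.length + 2) := by
    intro x y z u v w hu ht
    refine length_le_of_cover (hu.injOn_take x)
      (X := fun j => O (y * (v.take j).prod)) (Y := fun j => F (z * (w.take j).prod))
      (fun j => (hO _).trans (le_max_right _ _)) (fun j => (hFc _).trans (le_max_left _ _)) ?_
    intro i hi
    rcases ht i hi with ⟨j, hj, m, hm, h⟩ | ⟨j, hj, m, hm, h⟩
    · exact Or.inl ⟨j, hj, Finset.mem_image.2 ⟨m, by simpa using hm, h⟩⟩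
    · exact Or.inr ⟨j, hj, hF _ _ m hm h⟩
  obtain ⟨-, h2, h3⟩ := hthin p q r hp hq hr he
  refine ⟨?_, key hq h3⟩
  rw [add_comm q.length]
  exact key hp h2

end Fibres

/-! ### Rewriting with a bounded buffer between two stacks. -/

section Moves

variable {M : Type*} [Monoid M]

/-- One move of a buffer with contents in `B` between two stacks: a letter is absorbed into the
buffer, or split off from it, on one of the two sides. The left stack is listed from its top. -/
inductive Move (B : Set M) : List M × M × List M → List M × M × List M → Prop
  | absorbRight (L : List M) {b y : M} (R : List M) (hb : b ∈ B) (hy : y ∈ B) (hby : b * y ∈ B) :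
      Move B (L, b, y :: R) (L, b * y, R)
  | emitRight (L : List M) {b y : M} (R : List M) (hb : b ∈ B) (hy : y ∈ B) (hby : b * y ∈ B) :
      Move B (L, b * y, R) (L, b, y :: R)
  | absorbLeft {x : M} (L : List M) {b : M} (R : List M) (hb : b ∈ B) (hx : x ∈ B)
      (hxb : x * b ∈ B) : Move B (x :: L, b, R) (L, x * b, R)
  | emitLeft {x : M} (L : List M) {b : M} (R : List M) (hb : b ∈ B) (hx : x ∈ B)
      (hxb : x * b ∈ B) : Move B (L, x * b, R) (x :: L, b, R)

/-- The second configuration can be reached from the first by at most `n` moves. -/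
inductive Moves (B : Set M) : ℕ → List M × M × List M → List M × M × List M → Prop
  | refl (n : ℕ) (c : List M × M × List M) : Moves B n c c
  | step {n : ℕ} {c d e : List M × M × List M} : Move B c d → Moves B n d e → Moves B (n + 1) c e

variable {B : Set M} {c d e : List M × M × List M} {m n : ℕ}

/-- Reversibility is what allows the reduction of a word to its normal form to be run backwards. -/
theorem Move.symm (h : Move B c d) : Move B d c := by
  cases h with
  | absorbRight L R hb hy hby => exact .emitRight L R hb hy hby
  | emitRight L R hb hy hby => exact .absorbRight L R hb hy hby
  | absorbLeft L R hb hx hxb => exact .emitLeft L R hb hx hxb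
  | emitLeft L R hb hx hxb => exact .absorbLeft L R hb hx hxb

theorem Move.moves (h : Move B c d) : Moves B 1 c d :=
  .step h (.refl 0 d)

theorem Moves.mono (h : Moves B m c d) (hmn : m ≤ n) : Moves B n c d := by
  induction h generalizing n with
  | refl => exact .refl _ _
  | @step k _ _ _ h _ ih =>
    obtain ⟨n, rfl⟩ : ∃ n', n = n' + 1 := ⟨n - 1, by omega⟩
    exact .step h (ih (by omega))

theorem Moves.trans (h : Moves B m c d) (h' : Moves B n d e) : Moves B (m + n) c e := by
  induction h with
  | refl => exact h'.mono (by omega)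
  | step h _ ih =>
    rw [Nat.add_right_comm]
    exact .step h (ih h')

theorem Moves.symm (h : Moves B m c d) : Moves B m d c := by
  induction h with
  | refl => exact .refl _ _
  | step h _ ih => exact ih.trans h.symm.moves

/-- Each letter costs two moves: it enters the trivial buffer from the right and leaves it on the
left. -/
theorem Moves.shift (h1 : (1 : M) ∈ B) {r : List M} (hr : ∀ s ∈ r, s ∈ B) (L R : List M) :
    Moves B (2 * r.length) (L, 1, r ++ R) (r.reverse ++ L, 1, R) := by
  induction r generalizing L with
  | nil => exact .refl _ _
  | cons x r ih =>
    have hx := hr x (by simp)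
    have h2 : Move B (L, 1, x :: (r ++ R)) (L, 1 * x, r ++ R) :=
      .absorbRight L _ h1 hx (by simpa using hx)
    have h3 : Move B (L, x * 1, r ++ R) (x :: L, 1, r ++ R) :=
      .emitLeft L _ h1 hx (by simpa using hx)
    rw [mul_one] at h3
    rw [one_mul] at h2
    have h4 := ih (fun s hs => hr s (by simp [hs])) (x :: L)
    have h5 := h2.moves.trans (h3.moves.trans h4)
    simp only [List.reverse_cons, List.append_assoc, List.cons_append, List.nil_append]
    exact h5.mono (by simp; omega)

/-- The top of the stack is the last letter of `t`, so the buffer grows by left multiplication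
through suffixes of `t`; `N` bounds all intermediate values. -/
theorem Moves.absorbLeft {S : Finset M} {t : List M} (ht : ∀ s ∈ t, s ∈ S) {b : M} {m N : ℕ}
    (hb : b ∈ wordBall S m) (hN : t.length + m ≤ N) (L R : List M) :
    Moves (wordBall S N) t.length (t.reverse ++ L, b, R) (L, t.prod * b, R) := by
  induction t using List.reverseRecOn generalizing b m with
  | nil => simpa using Moves.refl _ _
  | append_singleton t x ih =>
    have hx : x ∈ wordBall S 1 := mem_wordBall_one (ht x (by simp))
    have hxb := mul_mem_wordBall hx hb
    rw [List.length_append, List.length_singleton] at hN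
    have h := ih (fun s hs => ht s (by simp [hs])) hxb (by omega)
    rw [List.length_append, List.length_singleton, List.reverse_append, List.prod_append]
    simp only [List.reverse_singleton, List.cons_append,
      List.prod_singleton, mul_assoc]
    exact .step (.absorbLeft _ _ (wordBall_mono (by omega) hb) (wordBall_mono (by omega) hx)
      (wordBall_mono (by omega) hxb)) h

end Moves

/-! ### Rewriting to geodesic normal forms in quadratically many moves. -/

section Triangles

theorem reverse_take_eq {α : Type*} (p : List α) {i j : ℕ} (hij : i ≤ j) :
    (p.take j).reverse = ((p.drop i).take (j - i)).reverse ++ (p.take i).reverse := by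
  rw [← List.reverse_append, ← List.take_add, Nat.add_sub_cancel' hij]

variable {M : Type*} [Monoid M] {S : Finset M} {D C k : ℕ}

theorem LinearSides.length_le (hS : Generates S) (hlin : LinearSides S C) {t : List M}
    (ht : IsGeodesicWord S t) {a b : M} {m n : ℕ} (ha : a ∈ wordBall S m) (hb : b ∈ wordBall S n)
    (h : t.prod * a = b) : t.length ≤ C * (m + n + 2) := by
  obtain ⟨u, hu, rfl⟩ := exists_geodesicWord hS a
  obtain ⟨v, hv, rfl⟩ := exists_geodesicWord hS b
  have h1 := (hlin t u v ht hu hv h).1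
  have h2 := hu.length_le ha
  have h3 := hv.length_le hb
  have : C * (u.length + v.length + 2) ≤ C * (m + n + 2) := Nat.mul_le_mul_left _ (by omega)
  omega

variable [IsLeftCancelMul M]

/-- The end of a triangle with a side of length at most `k` leaves the first side of the
triangle along paths of length at most `2 * D + k + 1`. -/
theorem ThinWords.fellow (hthin : ThinWords S D) {p q r : List M} (hp : IsGeodesicWord S p)
    (hq : IsGeodesicWord S q) (hr : IsGeodesicWord S r) (he : p.prod * q.prod = r.prod)
    (hk : q.length ≤ k) {i : ℕ} (hi : i ≤ r.length) :
    ∃ j ≤ p.length, ∃ m ∈ wordBall S (2 * D + k + 1),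
      (p.take j).prod * m = (r.take i).prod := by
  have h1 := (hthin p q r hp hq hr he).1
  -- A vertex of `r` near `q` is close to the end of `r`: going to `q` and then along `q` costs at
  -- most `D + k`, and the rest of `r` is geodesic.
  have near : ∀ i ≤ r.length,
      (∃ j ≤ p.length, ∃ m ∈ wordBall S D, (p.take j).prod * m = (r.take i).prod) ∨
      r.length ≤ i + (D + k) := by
    intro i hi
    rcases h1 i hi with ⟨j, hj, m, hm, h⟩ | ⟨j, hj, m, hm, h⟩
    · exact Or.inl ⟨j, hj, m, hm, by simpa using h⟩
    · right
      have h2 : (r.drop i).prod = m * (q.drop j).prod := by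
        apply mul_left_cancel (a := (r.take i).prod)
        rw [List.prod_take_mul_prod_drop, ← he, ← List.prod_take_mul_prod_drop q j, ← mul_assoc,
          ← mul_assoc, ← h, one_mul]
      have h3 := (hr.drop i).length_le (n := D + k) (by
        rw [h2]
        exact mul_mem_wordBall hm (prod_mem_wordBall (hq.drop j).1 (by simp; omega)))
      simp at h3
      omega
  rcases near i hi with ⟨j, hj, m, hm, h⟩ | hlast
  · exact ⟨j, hj, m, wordBall_mono (by omega) hm, h⟩
  -- The vertex `D + k + 1` steps before the end is too far from it for the second alternative, so
  -- it is near `p`. Reaching index `i` from there adds at most `D + k + 1` to `D`. If the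
  -- subtraction truncates to `0`, the common starting vertex serves instead.
  set i' := r.length - (D + k + 1) with hi'
  have hle : i' ≤ i := by omega
  have hseg := prod_take_mul_prod_drop_take r hle
  have hball : ((r.drop i').take (i - i')).prod ∈ wordBall S (D + k + 1) :=
    prod_mem_wordBall ((hr.drop i').take _).1 (by simp; omega)
  rcases Nat.eq_zero_or_pos i' with h0 | h0
  · refine ⟨0, by omega, _, wordBall_mono (by omega) hball, ?_⟩
    rw [← hseg, h0]
    simp
  · rcases near i' (by omega) with ⟨j, hj, m, hm, h⟩ | h
    · refine ⟨j, hj, _, wordBall_mono (by omega) (mul_mem_wordBall hm hball), ?_⟩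
      rw [← hseg, ← mul_assoc, h]
    · omega

/-- One step back along `r`, over its letter `y`: the connecting path from `p` changes from `s'` to
`s`, and its foot from index `j'` to `j`. The segment `t` of `p` between the two feet is a side of a
triangle whose other sides have length at most `E` and `E + 1`, so `t` has length at most `C * (2 *
E + 3)` and passes through the buffer. -/
theorem LinearSides.moves_step (hS : Generates S) (hlin : LinearSides S C) {p : List M}
    (hp : IsGeodesicWord S p) {E : ℕ} {j j' : ℕ} {s s' y : M} (hs : s ∈ wordBall S E)
    (hs' : s' ∈ wordBall S E) (hy : y ∈ S)
    (h : (p.take j').prod * s' = (p.take j).prod * s * y) (R : List M) :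
    Moves (wordBall S (C * (2 * E + 3) + E + 1)) (C * (2 * E + 3) + 1)
      ((p.take j').reverse, s', R) ((p.take j).reverse, s, y :: R) := by
  have hy1 : y ∈ wordBall S 1 := mem_wordBall_one hy
  have hsy := mul_mem_wordBall hs hy1
  -- If the foot moves back, `t` is absorbed first and then `y` is split off. If it moves forward,
  -- `y` is split off first, leaving `t.prod * s`, and then `t` is pushed back onto the left stack
  -- by absorption in reverse.
  rcases le_total j j' with hjj | hjj
  · rw [reverse_take_eq p hjj]
    set t := (p.drop j).take (j' - j) with ht
    have htg : IsGeodesicWord S t := (hp.drop j).take _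
    have hts : t.prod * s' = s * y := by
      apply mul_left_cancel (a := (p.take j).prod)
      rw [← mul_assoc, prod_take_mul_prod_drop_take p hjj, h, mul_assoc]
    have hlen := hlin.length_le hS htg hs' hsy hts
    rw [show E + (E + 1) + 2 = 2 * E + 3 by ring] at hlen
    have h1 := Moves.absorbLeft htg.1 hs' (N := C * (2 * E + 3) + E + 1) (by omega)
      (p.take j).reverse R
    rw [hts] at h1
    refine (h1.trans (Move.emitRight _ _ ?_ ?_ ?_).moves).mono (by omega)
    · exact wordBall_mono (by omega) hs
    · exact wordBall_mono (by omega) hy1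
    · exact wordBall_mono (by omega) hsy
  · rw [reverse_take_eq p hjj]
    set t := (p.drop j').take (j - j') with ht
    have htg : IsGeodesicWord S t := (hp.drop j').take _
    have hts : t.prod * (s * y) = s' := by
      apply mul_left_cancel (a := (p.take j').prod)
      rw [← mul_assoc, prod_take_mul_prod_drop_take p hjj, h, mul_assoc]
    have hlen := hlin.length_le hS htg hsy hs' hts
    rw [show E + 1 + E + 2 = 2 * E + 3 by ring] at hlen
    have h1 := (Moves.absorbLeft htg.1 hs (N := C * (2 * E + 3) + E + 1) (by omega)
      (p.take j').reverse (y :: R)).symm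
    have h2 : Move (wordBall S (C * (2 * E + 3) + E + 1)) ((p.take j').reverse, s', R)
        ((p.take j').reverse, t.prod * s, y :: R) := by
      rw [← hts, ← mul_assoc]
      refine .emitRight _ _ ?_ (wordBall_mono (by omega) hy1) ?_
      · exact wordBall_mono (by omega)
          (mul_mem_wordBall (prod_mem_wordBall htg.1 le_rfl) hs)
      · rw [mul_assoc, hts]
        exact wordBall_mono (by omega) hs'
    exact (h2.moves.trans h1).mono (by omega)

/-- A geodesic word `p`, followed by a buffer, is transformed into a geodesic word `r`. -/
theorem moves_triangle (hS : Generates S) (hthin : ThinWords S D) (hlin : LinearSides S C)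
    {p r : List M} (hp : IsGeodesicWord S p) (hr : IsGeodesicWord S r) {a : M}
    (ha : a ∈ wordBall S k) (he : p.prod * a = r.prod) {E : ℕ} (hE : E = 2 * D + k + 1)
    (R : List M) :
    Moves (wordBall S (C * (2 * E + 3) + E + 1)) ((C * (2 * E + 3) + 1) * (r.length + 1))
      (p.reverse, a, R) ([], 1, r ++ R) := by
  obtain ⟨q, hq, rfl⟩ := exists_geodesicWord hS a
  -- The connecting path `s` and its foot `j` are arbitrary, so that the induction can pass to the
  -- pair supplied by `ThinWords.fellow` at the preceding vertex.
  have key : ∀ i ≤ r.length, ∀ j, ∀ s ∈ wordBall S E, (p.take j).prod * s = (r.take i).prod →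
      ∀ R, Moves (wordBall S (C * (2 * E + 3) + E + 1)) ((C * (2 * E + 3) + 1) * (i + 1))
        ((p.take j).reverse, s, R) ([], 1, r.take i ++ R) := by
    intro i
    induction i with
    | zero =>
      intro _ j s hs h R
      rw [List.take_zero, List.prod_nil] at h
      have hlen := hlin.length_le hS (hp.take j) hs (one_mem_wordBall 0) h
      have hle : C * (E + 0 + 2) ≤ C * (2 * E + 3) := Nat.mul_le_mul_left _ (by omega)
      have h1 := Moves.absorbLeft (hp.take j).1 hs (N := C * (2 * E + 3) + E + 1) (by omega) [] R
      rw [h, List.append_nil] at h1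
      exact h1.mono (by omega)
    | succ i ih =>
      intro hi j' s' hs' h' R
      obtain ⟨j, -, s, hs, h⟩ := hthin.fellow hp hq hr he (hq.length_le ha)
        (show i ≤ r.length by omega)
      rw [← hE] at hs
      rw [List.prod_take_succ r i hi, ← h] at h'
      have h1 := hlin.moves_step hS hp hs hs' (hr.1 _ (List.getElem_mem hi)) h' R
      have h2 := ih (by omega) j s hs h (r[i] :: R)
      rw [← List.take_concat_get' r i hi, List.append_assoc, List.singleton_append]
      exact (h1.trans h2).mono (by ring_nf; rfl)
  have := key r.length le_rfl p.length q.prod (wordBall_mono (by omega) ha)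
    (by rw [List.take_length, List.take_length, he]) R
  rwa [List.take_length, List.take_length] at this

/-- Every word over `wordBall S k` is transformed into a geodesic word, appended to the left
stack, that depends only on the element represented by the word. -/
theorem moves_geodesic (hS : Generates S) (hthin : ThinWords S D) (hlin : LinearSides S C)
    {geo : M → List M} (hgeo : ∀ x, IsGeodesicWord S (geo x) ∧ (geo x).prod = x)
    {E : ℕ} (hE : E = 2 * D + k + 1) (x : M) {n : ℕ} (hx : x ∈ wordBall S n)
    (u : List M) (hu : ∀ s ∈ u, s ∈ wordBall S k) :
    Moves (wordBall S (C * (2 * E + 3) + E + 1))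
      (u.length * ((C * (2 * E + 3) + 4) * (n + k * u.length + 1)))
      ((geo x).reverse, 1, u) ((geo (x * u.prod)).reverse, 1, []) := by
  induction u generalizing x n with
  | nil => simpa using Moves.refl _ _
  | cons a u ih =>
    have ha := hu a (by simp)
    have hxa := mul_mem_wordBall hx ha
    have hlen := (hgeo (x * a)).1.length_le (n := n + k) (by rwa [(hgeo (x * a)).2])
    set K := C * (2 * E + 3) with hK
    have h1 : Move (wordBall S (K + E + 1)) ((geo x).reverse, 1, a :: u)
        ((geo x).reverse, 1 * a, u) :=
      .absorbRight _ _ (one_mem_wordBall _) (wordBall_mono (by omega) ha)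
        (by rw [one_mul]; exact wordBall_mono (by omega) ha)
    rw [one_mul] at h1
    have h2 := moves_triangle hS hthin hlin (hgeo x).1 (hgeo (x * a)).1 ha
      (by rw [(hgeo x).2, (hgeo _).2]) hE u
    have h3 := Moves.shift (B := wordBall S (K + E + 1)) (one_mem_wordBall _)
      (r := geo (x * a)) (fun s hs => wordBall_mono (by omega)
        (mem_wordBall_one ((hgeo (x * a)).1.1 s hs))) [] u
    rw [List.append_nil] at h3
    have h4 := ih (x * a) hxa (fun s hs => hu s (by simp [hs]))
    rw [List.prod_cons, ← mul_assoc x a]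
    refine (h1.moves.trans (h2.trans (h3.trans h4))).mono ?_
    rw [List.length_cons]
    have e1 : n + k + k * u.length + 1 = n + k * (u.length + 1) + 1 := by ring
    rw [e1, add_mul u.length, one_mul, add_comm (u.length * _), ← add_assoc, ← add_assoc]
    -- What remains is the cost of one letter: one absorption, the rewriting of the triangle, and
    -- the transfer of the new geodesic back to the left stack.
    refine Nat.add_le_add_right ?_ _
    calc 1 + (K + 1) * ((geo (x * a)).length + 1) + 2 * (geo (x * a)).length
        ≤ 1 + (K + 1) * (n + k + 1) + 2 * (n + k) := by gcongr
      _ ≤ (K + 4) * (n + k + 1) := by nlinarith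
      _ ≤ (K + 4) * (n + k * (u.length + 1) + 1) := by gcongr; nlinarith

/-- Words that represent the same element are transformed into each other. -/
theorem moves_of_prod_eq (hS : Generates S) (hthin : ThinWords S D) (hlin : LinearSides S C)
    (k : ℕ) : ∃ B : Set M, B.Finite ∧ wordBall S k ⊆ B ∧ ∃ c : ℕ, ∀ u v : List M,
      (∀ s ∈ u, s ∈ wordBall S k) → (∀ s ∈ v, s ∈ wordBall S k) → u.prod = v.prod →
      Moves B (c * (u.length + v.length + 1) ^ 2) ([], 1, u) (v.reverse, 1, []) := by
  choose geo hgeo hgeo' using exists_geodesicWord hS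
  set E := 2 * D + k + 1 with hE
  set K := C * (2 * E + 3) with hK
  refine ⟨wordBall S (K + E + 1), finite_wordBall S _, wordBall_mono (by omega),
    (K + 4) * (k + 1) * 4, fun u v hu hv huv => ?_⟩
  -- The normal form of `1` is empty, so the reduction can start with an empty left stack.
  have hnil : geo 1 = [] := List.length_eq_zero_iff.1 (Nat.le_zero.1
    ((hgeo 1).length_le (by rw [hgeo']; exact one_mem_wordBall 0)))
  have key : ∀ w : List M, (∀ s ∈ w, s ∈ wordBall S k) →
      Moves (wordBall S (K + E + 1)) (w.length * ((K + 4) * (0 + k * w.length + 1)))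
        ([], 1, w) ((geo w.prod).reverse, 1, []) := by
    intro w hw
    have := moves_geodesic hS hthin hlin (fun x => ⟨hgeo x, hgeo' x⟩) hE 1 (one_mem_wordBall 0) w hw
    rwa [hnil, one_mul] at this
  have h1 := key u hu
  have h2 := (key v hv).symm
  have h3 := Moves.shift (B := wordBall S (K + E + 1)) (one_mem_wordBall _)
      (r := v) (fun s hs => wordBall_mono (by omega) (hv s hs)) [] []
  rw [List.append_nil, List.append_nil] at h3
  -- Equal values have the same normal form, so the reversed reduction of `v` starts where the
  -- reduction of `u` ends.
  rw [← huv] at h2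
  refine (h1.trans (h2.trans h3)).mono ?_
  have est : ∀ n : ℕ, n ≤ u.length + v.length →
      n * ((K + 4) * (0 + k * n + 1)) ≤ (K + 4) * (k + 1) * (u.length + v.length + 1) ^ 2 := by
    intro n hn
    calc n * ((K + 4) * (0 + k * n + 1)) = (K + 4) * (n * (k * n + 1)) := by ring
      _ ≤ (K + 4) * ((k + 1) * (u.length + v.length + 1) ^ 2) := by
        refine Nat.mul_le_mul_left _ ?_
        have : n * (k * n + 1) ≤ (k + 1) * (n + 1) ^ 2 := by nlinarith
        refine this.trans ?_
        gcongr
      _ = _ := by ring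
  have e1 := est u.length (by omega)
  have e2 := est v.length (by omega)
  have e3 : 2 * v.length ≤ (K + 4) * (k + 1) * (u.length + v.length + 1) ^ 2 := by
    calc 2 * v.length ≤ 4 * 1 * (u.length + v.length + 1) ^ 2 := by nlinarith
      _ ≤ _ := by gcongr <;> omega
  nlinarith

end Triangles

/-! ### Two-way tapes as pairs of lists. -/

section Tapes

open Turing

variable {Λ : Type*}

/-- One-sided tapes are lists modulo trailing blanks. This is why erased cells at the end of a stack
leave no trace. -/
theorem mk_blank : ListBlank.mk [(none : Option Λ)] = ListBlank.mk [] :=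
  Quotient.sound' (Or.inr ⟨1, rfl⟩)

theorem mk₂_blank_left (R : List (Option Λ)) : Tape.mk₂ [none] R = Tape.mk₂ [] R := by
  rw [Tape.mk₂, Tape.mk₂, mk_blank]

theorem mk₂_blank_right (L : List (Option Λ)) : Tape.mk₂ L [none] = Tape.mk₂ L [] := by
  rw [Tape.mk₂, Tape.mk₂, mk_blank]

theorem head_mk₂_cons (L : List (Option Λ)) (a : Option Λ) (R : List (Option Λ)) :
    (Tape.mk₂ L (a :: R)).head = a := rfl

theorem move_right_mk₂ (L : List (Option Λ)) (a : Option Λ) (R : List (Option Λ)) :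
    (Tape.mk₂ L (a :: R)).move Dir.right = Tape.mk₂ (a :: L) R := by
  simp [Tape.mk₂]

theorem move_left_mk₂_cons (a : Option Λ) (L R : List (Option Λ)) :
    (Tape.mk₂ (a :: L) R).move Dir.left = Tape.mk₂ L (a :: R) := by
  simp [Tape.mk₂]

theorem move_left_mk₂_nil (R : List (Option Λ)) :
    (Tape.mk₂ [] R).move Dir.left = Tape.mk₂ [] (none :: R) := by
  simp only [Tape.mk₂, Tape.move_left_mk']
  rfl

theorem write_mk₂_cons (L : List (Option Λ)) (a b : Option Λ) (R : List (Option Λ)) :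
    (Tape.mk₂ L (a :: R)).write b = Tape.mk₂ L (b :: R) := by
  simp [Tape.mk₂]

theorem write_mk₂_nil (L : List (Option Λ)) (b : Option Λ) :
    (Tape.mk₂ L []).write b = Tape.mk₂ L [b] := by
  simp [Tape.mk₂]

end Tapes

/-! ### The Turing machine and its soundness. -/

section Machine

open Turing

/-- The states of the buffer machine: `work b` with buffer `b`, two intermediate states of its
stack operations, and the states of the final comparison. -/
inductive BufferState (Γ : Type) : Type
  | work (b : Γ)
  | push (b g : Γ)
  | pop (b : Γ)
  | drop
  | dropping
  | toEnd
  | compare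
  | done

instance {Γ : Type} [Finite Γ] : Finite (BufferState Γ) := by
  let F : Γ ⊕ (Γ × Γ) ⊕ Γ ⊕ Fin 5 → BufferState Γ
    | .inl b => .work b
    | .inr (.inl (b, g)) => .push b g
    | .inr (.inr (.inl b)) => .pop b
    | .inr (.inr (.inr 0)) => .drop
    | .inr (.inr (.inr 1)) => .dropping
    | .inr (.inr (.inr 2)) => .toEnd
    | .inr (.inr (.inr 3)) => .compare
    | .inr (.inr (.inr 4)) => .done
  refine Finite.of_surjective F ?_
  rintro (b | ⟨b, g⟩ | b | _ | _ | _ | _ | _)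
  · exact ⟨.inl b, rfl⟩
  · exact ⟨.inr (.inl (b, g)), rfl⟩
  · exact ⟨.inr (.inr (.inl b)), rfl⟩
  · exact ⟨.inr (.inr (.inr 0)), rfl⟩
  · exact ⟨.inr (.inr (.inr 1)), rfl⟩
  · exact ⟨.inr (.inr (.inr 2)), rfl⟩
  · exact ⟨.inr (.inr (.inr 3)), rfl⟩
  · exact ⟨.inr (.inr (.inr 4)), rfl⟩

variable {A M : Type*} [Monoid M] {Γ : Type}

/-- The transitions of the buffer machine. Tape `0` holds the right stack, whose top is scanned,
and tape `1` holds the left stack, the cell after its top being scanned. The stack on tape `0`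
initially is the input `u # v`. When `#` is on top of it and the buffer is trivial, the machine
drops some letters from the left stack (only if `P` holds) and then reads `v` backwards,
comparing it with the left stack, which has to be exhausted if `P` holds. -/
inductive BufferTrans (f : A → M) (γ : Γ → M) (P : Prop) :
    BufferState Γ → Option (Option A ⊕ Γ) → Option (Option A ⊕ Γ) → BufferState Γ →
      Option (Option A ⊕ Γ) × Option Dir → Option (Option A ⊕ Γ) × Option Dir → Prop
  | read (b b' : Γ) (a : A) (h : γ b' = γ b * f a) :
      BufferTrans f γ P (.work b) (some (.inl (some a))) none (.work b')
        (none, some .right) (none, none)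
  | absorbRight (b b' g : Γ) (h : γ b' = γ b * γ g) :
      BufferTrans f γ P (.work b) (some (.inr g)) none (.work b')
        (none, some .right) (none, none)
  | emitRight (b b' g : Γ) (s : Option (Option A ⊕ Γ)) (h : γ b = γ b' * γ g) :
      BufferTrans f γ P (.work b) s none (.push b' g) (s, some .left) (none, none)
  | push (b g : Γ) (s : Option (Option A ⊕ Γ)) :
      BufferTrans f γ P (.push b g) s none (.work b) (some (.inr g), none) (none, none)
  | absorbLeft (b : Γ) (s : Option (Option A ⊕ Γ)) :
      BufferTrans f γ P (.work b) s none (.pop b) (s, none) (none, some .left)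
  | pop (b b' g : Γ) (s : Option (Option A ⊕ Γ)) (h : γ b' = γ g * γ b) :
      BufferTrans f γ P (.pop b) s (some (.inr g)) (.work b') (s, none) (none, none)
  | emitLeft (b b' g : Γ) (s : Option (Option A ⊕ Γ)) (h : γ b = γ g * γ b') :
      BufferTrans f γ P (.work b) s none (.work b') (s, none) (some (.inr g), some .right)
  | finish (b : Γ) (h : γ b = 1) :
      BufferTrans f γ P (.work b) (some (.inl none)) none .drop
        (some (.inl none), none) (none, none)
  | drop (s : Option (Option A ⊕ Γ)) (h : P) :
      BufferTrans f γ P .drop s none .dropping (s, none) (none, some .left)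
  | dropping (s : Option (Option A ⊕ Γ)) (g : Γ) :
      BufferTrans f γ P .dropping s (some (.inr g)) .drop (s, none) (none, none)
  | advance (s : Option (Option A ⊕ Γ)) :
      BufferTrans f γ P .drop s none .toEnd (s, some .right) (none, none)
  | toEnd (a : A) :
      BufferTrans f γ P .toEnd (some (.inl (some a))) none .toEnd
        (some (.inl (some a)), some .right) (none, none)
  | turn : BufferTrans f γ P .toEnd none none .compare (none, some .left) (none, some .left)
  | compare (a : A) (g : Γ) (h : γ g = f a) :
      BufferTrans f γ P .compare (some (.inl (some a))) (some (.inr g)) .compare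
        (some (.inl (some a)), some .left) (none, some .left)
  | accept (s : Option (Option A ⊕ Γ)) (h : P → s = none) :
      BufferTrans f γ P .compare (some (.inl none)) s .done (some (.inl none), none) (s, none)

/-- The Turing machine with the transitions `BufferTrans`, started with buffer `e`. -/
def bufferMachine [Finite Γ] (f : A → M) (γ : Γ → M) (e : Γ) (P : Prop) : NTM (Option A) where
  tapes := 1
  Work := Γ
  finiteWork := inferInstance
  State := BufferState Γ
  finiteState := inferInstance
  start := .work e
  accept := .done
  trans q s := {t | BufferTrans f γ P q (s 0) (s 1) t.1 (t.2 0) (t.2 1)}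

/-- The tape that holds the right stack: buffer letters followed by a part of the input. -/
def rightTape (ρ : List Γ) (x : List (Option A)) : Tape (Option (Option A ⊕ Γ)) :=
  Tape.mk₂ [] (ρ.map (fun g => some (.inr g)) ++ x.map fun a => some (.inl a))

/-- The tape that holds the left stack. -/
def leftTape (A : Type*) {Γ : Type} (L : List Γ) : Tape (Option (Option A ⊕ Γ)) :=
  Tape.mk₂ (L.map fun g => some (.inr g)) []

/-- The tape that holds `# v x`, the head scanning the first letter of `x`. -/
def inputTape (Γ : Type) (v : List A) (x : List (Option A)) : Tape (Option (Option A ⊕ Γ)) :=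
  Tape.mk₂ ((v.map fun a => some (.inl (some a))).reverse ++ [some (.inl none)])
    (x.map fun a => some (.inl a))

/-- The configurations that the buffer machine can reach on the input `x`. -/
inductive BufferInv (f : A → M) (γ : Γ → M) (P : Prop) (x : List (Option A)) :
    BufferState Γ → Tape (Option (Option A ⊕ Γ)) → Tape (Option (Option A ⊕ Γ)) → Prop
  | work (u : List A) (y : List (Option A)) (L : List Γ) (b : Γ) (ρ : List Γ)
      (hx : x = u.map some ++ y)
      (h : (L.map γ).reverse.prod * γ b * (ρ.map γ).prod = (u.map f).prod) :
      BufferInv f γ P x (.work b) (rightTape ρ y) (leftTape A L)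
  | push (u : List A) (y : List (Option A)) (L : List Γ) (b g : Γ) (ρ : List Γ)
      (hx : x = u.map some ++ y)
      (h : (L.map γ).reverse.prod * γ b * γ g * (ρ.map γ).prod = (u.map f).prod) :
      BufferInv f γ P x (.push b g) ((rightTape ρ y).move .left) (leftTape A L)
  | pop (u : List A) (y : List (Option A)) (L : List Γ) (b : Γ) (ρ : List Γ)
      (hx : x = u.map some ++ y)
      (h : (L.map γ).reverse.prod * γ b * (ρ.map γ).prod = (u.map f).prod) :
      BufferInv f γ P x (.pop b) (rightTape ρ y) ((leftTape A L).move .left)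
  | drop (u : List A) (y : List (Option A)) (L : List Γ) (z : M)
      (hx : x = u.map some ++ none :: y) (hz : ¬ P → z = 1)
      (h : (L.map γ).reverse.prod * z = (u.map f).prod) :
      BufferInv f γ P x .drop (rightTape [] (none :: y)) (leftTape A L)
  | dropping (u : List A) (y : List (Option A)) (L : List Γ) (z : M)
      (hx : x = u.map some ++ none :: y) (hP : P)
      (h : (L.map γ).reverse.prod * z = (u.map f).prod) :
      BufferInv f γ P x .dropping (rightTape [] (none :: y)) ((leftTape A L).move .left)
  | toEnd (u v : List A) (y : List (Option A)) (L : List Γ) (z : M)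
      (hx : x = u.map some ++ none :: (v.map some ++ y)) (hz : ¬ P → z = 1)
      (h : (L.map γ).reverse.prod * z = (u.map f).prod) :
      BufferInv f γ P x .toEnd (inputTape Γ v y) (leftTape A L)
  | compare (u v w : List A) (L : List Γ) (z : M)
      (hx : x = u.map some ++ none :: (v ++ w).map some) (hz : ¬ P → z = 1)
      (h : (L.map γ).reverse.prod * (w.map f).prod * z = (u.map f).prod) :
      BufferInv f γ P x .compare ((inputTape Γ v (w.map some)).move .left)
        ((leftTape A L).move .left)
  | done (u v : List A) (y z : M) (T T' : Tape (Option (Option A ⊕ Γ)))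
      (hx : x = u.map some ++ none :: v.map some) (hy : P → y = 1) (hz : ¬ P → z = 1)
      (h : y * (v.map f).prod * z = (u.map f).prod) : BufferInv f γ P x .done T T'

theorem act_none {Λ : Type*} [Inhabited Λ] {T : Tape Λ} {s : Λ} (h : T.head = s) :
    NTM.act (s, none) T = T := by
  subst h; exact Tape.write_self T

theorem act_some {Λ : Type*} [Inhabited Λ] {T : Tape Λ} {s : Λ} (h : T.head = s) (d : Dir) :
    NTM.act (s, some d) T = T.move d := by
  subst h; exact congrArg (Tape.move d) (Tape.write_self T)

theorem act_right_mk₂_cons {Λ : Type*} (L : List (Option Λ)) (a b : Option Λ)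
    (R : List (Option Λ)) :
    NTM.act (b, some .right) (Tape.mk₂ L (a :: R)) = Tape.mk₂ (b :: L) R := by
  rw [← move_right_mk₂, ← write_mk₂_cons L a b R]
  rfl

theorem act_right_mk₂_nil {Λ : Type*} (L : List (Option Λ)) (b : Option Λ) :
    NTM.act (b, some .right) (Tape.mk₂ L []) = Tape.mk₂ (b :: L) [] := by
  rw [← move_right_mk₂, ← write_mk₂_nil L b]
  rfl

theorem head_leftTape (L : List Γ) : (leftTape A L).head = none := rfl

theorem head_move_leftTape_nil : ((leftTape A ([] : List Γ)).move .left).head = none := by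
  rw [leftTape, List.map_nil, move_left_mk₂_nil, head_mk₂_cons]

theorem head_move_leftTape_cons (g : Γ) (L : List Γ) :
    ((leftTape A (g :: L)).move .left).head = some (.inr g) := by
  rw [leftTape, List.map_cons, move_left_mk₂_cons, head_mk₂_cons]

/-- The head ends on the cell just erased, which is again the blank after the top of the shortened
stack. -/
theorem pop_leftTape (g : Γ) (L : List Γ) :
    NTM.act (none, none) ((leftTape A (g :: L)).move .left) = leftTape A L := by
  rw [leftTape, List.map_cons, move_left_mk₂_cons, NTM.act, write_mk₂_cons, mk₂_blank_right]
  rfl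

theorem pop_move_leftTape (g : Γ) (L : List Γ) :
    NTM.act (none, some .left) ((leftTape A (g :: L)).move .left) =
      (leftTape A L).move .left := by
  rw [← pop_leftTape g L]
  rfl

theorem push_leftTape (g : Γ) (L : List Γ) :
    NTM.act (some (.inr g), some .right) (leftTape A L) = leftTape A (g :: L) := by
  rw [leftTape, act_right_mk₂_nil]
  rfl

theorem pop_rightTape (g : Γ) (ρ : List Γ) (y : List (Option A)) :
    NTM.act (none, some .right) (rightTape (g :: ρ) y) = rightTape ρ y := by
  rw [rightTape, List.map_cons, List.cons_append, act_right_mk₂_cons,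
    mk₂_blank_left]
  rfl

theorem pop_rightTape_nil (a : Option A) (y : List (Option A)) :
    NTM.act (none, some .right) (rightTape ([] : List Γ) (a :: y)) = rightTape [] y := by
  rw [rightTape, List.map_nil, List.nil_append, List.map_cons, act_right_mk₂_cons,
    mk₂_blank_left]
  rfl

theorem push_rightTape (g : Γ) (ρ : List Γ) (y : List (Option A)) :
    NTM.act (some (.inr g), none) ((rightTape ρ y).move .left) = rightTape (g :: ρ) y := by
  rw [rightTape, move_left_mk₂_nil, NTM.act, write_mk₂_cons]
  rfl

theorem rightTape_move_right (y : List (Option A)) :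
    (rightTape ([] : List Γ) (none :: y)).move .right = inputTape Γ [] y := by
  rw [rightTape, List.map_nil, List.nil_append, List.map_cons, move_right_mk₂]
  rfl

theorem inputTape_move_right (v : List A) (a : A) (y : List (Option A)) :
    (inputTape Γ v (some a :: y)).move .right = inputTape Γ (v ++ [a]) y := by
  rw [inputTape, List.map_cons, move_right_mk₂]
  simp [inputTape]

theorem inputTape_move_left (v : List A) (a : A) (y : List (Option A)) :
    (inputTape Γ (v ++ [a]) y).move .left = inputTape Γ v (some a :: y) := by
  rw [← inputTape_move_right, Tape.move_right_left]

theorem head_inputTape_cons (v : List A) (a : Option A) (y : List (Option A)) :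
    (inputTape Γ v (a :: y)).head = some (.inl a) := rfl

theorem head_inputTape_nil (v : List A) : (inputTape Γ v []).head = none := rfl

theorem head_inputTape_move_left (y : List (Option A)) :
    ((inputTape Γ [] y).move .left).head = some (.inl none) := by
  rw [inputTape, List.map_nil, List.reverse_nil, List.nil_append, move_left_mk₂_cons,
    head_mk₂_cons]

theorem head_rightTape_cons (g : Γ) (ρ : List Γ) (y : List (Option A)) :
    (rightTape (g :: ρ) y).head = some (.inr g) := rfl

theorem head_rightTape_nil_cons (a : Option A) (y : List (Option A)) :
    (rightTape ([] : List Γ) (a :: y)).head = some (.inl a) := rfl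

theorem head_rightTape_nil_nil : (rightTape ([] : List Γ) ([] : List (Option A))).head = none :=
  rfl

/-- Every transition on the stacks preserves the product of left stack, buffer and right stack,
except that reading an input letter multiplies it on the right, as it does the value of the consumed
prefix. In the final phase, `z` collects the dropped letters and `w` the letters already matched. In
each case the scanned symbols determine the shape of the stacks. -/
theorem BufferInv.step {f : A → M} {γ : Γ → M} {P : Prop} {x : List (Option A)}
    {q q' : BufferState Γ} {T₀ T₁ : Tape (Option (Option A ⊕ Γ))}
    {s₀ s₁ : Option (Option A ⊕ Γ)} {a₀ a₁ : Option (Option A ⊕ Γ) × Option Dir}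
    (hI : BufferInv f γ P x q T₀ T₁) (h₀ : T₀.head = s₀) (h₁ : T₁.head = s₁)
    (ht : BufferTrans f γ P q s₀ s₁ q' a₀ a₁) :
    BufferInv f γ P x q' (NTM.act a₀ T₀) (NTM.act a₁ T₁) := by
  cases ht with
  | read b b' a hb =>
    cases hI with
    | work u y L _ ρ hx h =>
    rw [act_none h₁]
    cases ρ with
    | cons g ρ => rw [head_rightTape_cons] at h₀; simp at h₀
    | nil =>
    cases y with
    | nil => rw [head_rightTape_nil_nil] at h₀; simp at h₀
    | cons c y =>
    rw [head_rightTape_nil_cons] at h₀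
    obtain rfl : c = some a := by simpa using h₀
    rw [pop_rightTape_nil]
    refine .work (u ++ [a]) y L b' [] (by simp [hx]) ?_
    simp only [List.map_nil, List.prod_nil, mul_one] at h ⊢
    rw [hb, ← mul_assoc, h]
    simp
  | absorbRight b b' g hb =>
    cases hI with
    | work u y L _ ρ hx h =>
    rw [act_none h₁]
    cases ρ with
    | nil =>
      cases y with
      | nil => rw [head_rightTape_nil_nil] at h₀; simp at h₀
      | cons c y => rw [head_rightTape_nil_cons] at h₀; simp at h₀
    | cons g' ρ =>
    rw [head_rightTape_cons] at h₀
    obtain rfl : g' = g := by simpa using h₀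
    rw [pop_rightTape]
    refine .work u y L b' ρ hx ?_
    rw [← h, hb]
    simp [mul_assoc]
  | emitRight b b' g s hb =>
    cases hI with
    | work u y L _ ρ hx h =>
    rw [act_none h₁, act_some h₀]
    refine .push u y L b' g ρ hx ?_
    rw [← h, hb]
    simp [mul_assoc]
  | push b g s =>
    cases hI with
    | push u y L _ _ ρ hx h =>
    rw [act_none h₁, push_rightTape]
    refine .work u y L b (g :: ρ) hx ?_
    rw [← h]
    simp [mul_assoc]
  | absorbLeft b s =>
    cases hI with
    | work u y L _ ρ hx h =>
    rw [act_some h₁, act_none h₀]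
    exact .pop u y L b ρ hx h
  | pop b b' g s hb =>
    cases hI with
    | pop u y L _ ρ hx h =>
    rw [act_none h₀]
    cases L with
    | nil => rw [head_move_leftTape_nil] at h₁; simp at h₁
    | cons g' L =>
    rw [head_move_leftTape_cons] at h₁
    obtain rfl : g' = g := by simpa using h₁
    rw [pop_leftTape]
    refine .work u y L b' ρ hx ?_
    rw [← h, hb]
    simp [mul_assoc]
  | emitLeft b b' g s hb =>
    cases hI with
    | work u y L _ ρ hx h =>
    rw [act_none h₀, push_leftTape]
    refine .work u y (g :: L) b' ρ hx ?_
    rw [← h, hb]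
    simp [mul_assoc]
  | finish b hb =>
    cases hI with
    | work u y L _ ρ hx h =>
    rw [act_none h₀, act_none h₁]
    cases ρ with
    | cons g ρ => rw [head_rightTape_cons] at h₀; simp at h₀
    | nil =>
    cases y with
    | nil => rw [head_rightTape_nil_nil] at h₀; simp at h₀
    | cons c y =>
    rw [head_rightTape_nil_cons] at h₀
    obtain rfl : c = none := by simpa using h₀
    refine .drop u y L 1 hx (fun _ => rfl) ?_
    rw [← h, hb]
    simp
  | drop s hP =>
    cases hI with
    | drop u y L z hx hz h =>
    rw [act_none h₀, act_some h₁]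
    exact .dropping u y L z hx hP h
  | dropping s g =>
    cases hI with
    | dropping u y L z hx hP h =>
    rw [act_none h₀]
    cases L with
    | nil => rw [head_move_leftTape_nil] at h₁; simp at h₁
    | cons g' L =>
    rw [pop_leftTape]
    -- The dropped letter joins `z` on the left, as it comes from the top of the left stack.
    refine .drop u y L (γ g' * z) hx (fun hn => (hn hP).elim) ?_
    rw [← h]
    simp [mul_assoc]
  | advance s =>
    cases hI with
    | drop u y L z hx hz h =>
    rw [act_some h₀, act_none h₁, rightTape_move_right]
    exact .toEnd u [] y L z hx hz h
  | toEnd a =>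
    cases hI with
    | toEnd u v y L z hx hz h =>
    rw [act_some h₀, act_none h₁]
    cases y with
    | nil => rw [head_inputTape_nil] at h₀; simp at h₀
    | cons c y =>
    rw [head_inputTape_cons] at h₀
    obtain rfl : c = some a := by simpa using h₀
    rw [inputTape_move_right]
    exact .toEnd u (v ++ [a]) y L z (by simp [hx]) hz h
  | turn =>
    cases hI with
    | toEnd u v y L z hx hz h =>
    rw [act_some h₀, act_some h₁]
    cases y with
    | cons c y => rw [head_inputTape_cons] at h₀; simp at h₀
    | nil => exact .compare u v [] L z (by simp [hx]) hz (by simpa using h)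
  | compare a g hb =>
    cases hI with
    | compare u v w L z hx hz h =>
    rw [act_some h₀]
    cases L with
    | nil => rw [head_move_leftTape_nil] at h₁; simp at h₁
    | cons g' L =>
    rw [head_move_leftTape_cons] at h₁
    obtain rfl : g' = g := by simpa using h₁
    rw [pop_move_leftTape]
    cases v using List.reverseRecOn with
    | nil => rw [head_inputTape_move_left] at h₀; simp at h₀
    | append_singleton v a' =>
    rw [inputTape_move_left] at h₀ ⊢
    rw [head_inputTape_cons] at h₀
    obtain rfl : a' = a := by simpa using h₀
    refine .compare u v (a' :: w) L z (by simp [hx]) hz ?_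
    rw [← h]
    simp [mul_assoc, hb]
  | accept s hs =>
    cases hI with
    | compare u v w L z hx hz h =>
    cases v using List.reverseRecOn with
    | append_singleton v a' => rw [inputTape_move_left, head_inputTape_cons] at h₀; simp at h₀
    | nil =>
    -- What is left of the left stack is the factor `y`; if `P` holds, the blank scanned on tape `1`
    -- forces this stack to be empty.
    refine .done u w (L.map γ).reverse.prod z _ _ hx (fun hP => ?_) hz h
    cases L with
    | nil => simp
    | cons g L => rw [head_move_leftTape_cons, hs hP] at h₁; simp at h₁

variable [Finite Γ] {f : A → M} {γ : Γ → M} {e : Γ} {P : Prop}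

theorem BufferInv.of_reaches {x : List (Option A)} {n : ℕ} {c d : (bufferMachine f γ e P).Cfg}
    (h : (bufferMachine f γ e P).Reaches n c d)
    (hc : BufferInv f γ P x c.state (c.tape 0) (c.tape 1)) :
    BufferInv f γ P x d.state (d.tape 0) (d.tape 1) := by
  induction h with
  | refl => exact hc
  | step h _ ih =>
    obtain ⟨t, ht, hq, hT⟩ := h
    refine ih ?_
    rw [hq, hT]
    exact hc.step rfl rfl ht

theorem bufferMachine_sound (he : γ e = 1) {x : List (Option A)} {n : ℕ}
    (h : (bufferMachine f γ e P).AcceptsIn x n) :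
    ∃ u v : List A, x = u.map some ++ none :: v.map some ∧ ∃ y z : M, (P → y = 1) ∧ (¬ P → z = 1) ∧
      y * (v.map f).prod * z = (u.map f).prod := by
  obtain ⟨c, hc, hacc⟩ := h
  have h0 : BufferInv f γ P x ((bufferMachine f γ e P).init x).state
      (((bufferMachine f γ e P).init x).tape 0) (((bufferMachine f γ e P).init x).tape 1) := by
    -- Initially no input is consumed, both stacks of buffer letters are empty and the buffer
    -- represents `1`.
    exact .work [] x [] e [] rfl (by simp [he])
  have h1 := h0.of_reaches hc
  rw [hacc] at h1
  generalize c.tape 0 = T at h1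
  generalize c.tape 1 = T' at h1
  cases h1 with
  | done u v y z _ _ hx hy hz h => exact ⟨u, v, hx, y, z, hy, hz, h⟩

end Machine

/-! ### Simulation of moves and accepting computations. -/

section Completeness

open Turing

/-- There is a computation of at most `n` steps from the first to the second configuration. -/
def NTM.ReachesLE {A : Type*} (N : NTM A) (n : ℕ) (c d : N.Cfg) : Prop :=
  ∃ k ≤ n, N.Reaches k c d

theorem NTM.Reaches.trans {A : Type*} {N : NTM A} {m n : ℕ} {c d e : N.Cfg}
    (h : N.Reaches m c d) (h' : N.Reaches n d e) : N.Reaches (m + n) c e := by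
  induction h with
  | refl => rwa [Nat.zero_add]
  | step h _ ih =>
    rw [Nat.add_right_comm]
    exact .step h (ih h')

theorem NTM.ReachesLE.refl {A : Type*} {N : NTM A} (n : ℕ) (c : N.Cfg) : N.ReachesLE n c c :=
  ⟨0, Nat.zero_le n, .refl c⟩

theorem NTM.ReachesLE.trans {A : Type*} {N : NTM A} {m n : ℕ} {c d e : N.Cfg}
    (h : N.ReachesLE m c d) (h' : N.ReachesLE n d e) : N.ReachesLE (m + n) c e := by
  obtain ⟨k, hk, h⟩ := h
  obtain ⟨l, hl, h'⟩ := h'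
  exact ⟨k + l, Nat.add_le_add hk hl, h.trans h'⟩

theorem NTM.ReachesLE.mono {A : Type*} {N : NTM A} {m n : ℕ} {c d : N.Cfg}
    (h : N.ReachesLE m c d) (hmn : m ≤ n) : N.ReachesLE n c d := by
  obtain ⟨k, hk, h⟩ := h
  exact ⟨k, hk.trans hmn, h⟩

variable {A M : Type*} [Monoid M] {Γ : Type} [Finite Γ] {f : A → M} {γ : Γ → M} {e : Γ} {P : Prop}

/-- The configuration of the buffer machine with the given state and tapes. -/
def bufferCfg (f : A → M) (γ : Γ → M) (e : Γ) (P : Prop) (q : BufferState Γ)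
    (T₀ T₁ : Tape (Option (Option A ⊕ Γ))) : (bufferMachine f γ e P).Cfg where
  state := q
  tape i := if i = 0 then T₀ else T₁

theorem bufferCfg_step {q q' : BufferState Γ} {T₀ T₁ T₀' T₁' : Tape (Option (Option A ⊕ Γ))}
    {s₀ s₁ : Option (Option A ⊕ Γ)} {a₀ a₁ : Option (Option A ⊕ Γ) × Option Dir}
    (ht : BufferTrans f γ P q s₀ s₁ q' a₀ a₁) (h₀ : T₀.head = s₀) (h₁ : T₁.head = s₁)
    (e₀ : NTM.act a₀ T₀ = T₀') (e₁ : NTM.act a₁ T₁ = T₁') :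
    (bufferMachine f γ e P).ReachesLE 1 (bufferCfg f γ e P q T₀ T₁)
      (bufferCfg f γ e P q' T₀' T₁') := by
  subst h₀ h₁ e₀ e₁
  refine ⟨1, le_rfl, .step ⟨(q', fun i => if i = 0 then a₀ else a₁), ht, rfl, ?_⟩ (.refl _)⟩
  funext i
  by_cases hi : i = 0
  · simp only [bufferCfg, hi]; rfl
  · simp only [bufferCfg, hi]; rfl

/-- The configuration of the buffer machine that encodes stacks and a buffer over `M`, the
input letters `x` being below the right stack. -/
def workCfg (f : A → M) (γ : Γ → M) (e : Γ) (P : Prop) (σ : M → Γ) (x : List (Option A))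
    (c : List M × M × List M) : (bufferMachine f γ e P).Cfg :=
  bufferCfg f γ e P (.work (σ c.2.1)) (rightTape (c.2.2.map σ) x) (leftTape A (c.1.map σ))

variable {B : Set M} {σ : M → Γ} {x : List (Option A)}

/-- Splitting off to the right and absorbing from the left take two steps, since the head must move
before it writes or reads; the other two moves take one. -/
theorem workCfg_move (hσ : ∀ m ∈ B, γ (σ m) = m) {c d : List M × M × List M} (h : Move B c d) :
    (bufferMachine f γ e P).ReachesLE 2 (workCfg f γ e P σ x c) (workCfg f γ e P σ x d) := by
  cases h with
  | @absorbRight L b y R hb hy hby =>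
    exact (bufferCfg_step (.absorbRight _ (σ (b * y)) (σ y) (by rw [hσ _ hb, hσ _ hy, hσ _ hby]))
      rfl rfl (pop_rightTape _ _ _) (act_none rfl)).mono (by omega)
  | @emitRight L b y R hb hy hby =>
    exact (bufferCfg_step (.emitRight _ (σ b) (σ y) _ (by rw [hσ _ hb, hσ _ hy, hσ _ hby]))
      rfl rfl (act_some rfl _) (act_none rfl)).trans
      (bufferCfg_step (.push _ _ _) rfl rfl (push_rightTape _ _ _) (act_none rfl))
  | @absorbLeft x L b R hb hx hxb =>
    exact (bufferCfg_step (.absorbLeft _ _) rfl rfl (act_none rfl)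
      (act_some (head_leftTape _) _)).trans
      (bufferCfg_step (.pop _ (σ (x * b)) (σ x) _ (by rw [hσ _ hb, hσ _ hx, hσ _ hxb])) rfl
        (head_move_leftTape_cons _ _) (act_none rfl) (pop_leftTape _ _))
  | @emitLeft x L b R hb hx hxb =>
    exact (bufferCfg_step (.emitLeft _ (σ b) (σ x) _ (by rw [hσ _ hb, hσ _ hx, hσ _ hxb]))
      rfl rfl (act_none rfl) (push_leftTape _ _)).mono (by omega)

theorem workCfg_moves (hσ : ∀ m ∈ B, γ (σ m) = m) {n : ℕ} {c d : List M × M × List M}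
    (h : Moves B n c d) :
    (bufferMachine f γ e P).ReachesLE (2 * n) (workCfg f γ e P σ x c)
      (workCfg f γ e P σ x d) := by
  induction h with
  | refl => exact .refl _ _
  | step h _ ih => exact ((workCfg_move hσ h).trans ih).mono (by omega)

/-- Reading replaces the input letters of `u` by their codes on the left stack and uncovers `#`, so
that from then on all moves concern coded letters only. -/
theorem workCfg_read (hσ : ∀ m ∈ B, γ (σ m) = m) (h1 : (1 : M) ∈ B) (hf : ∀ a, f a ∈ B)
    (u : List A) (L : List M) :
    (bufferMachine f γ e P).ReachesLE (2 * u.length) (workCfg f γ e P σ (u.map some ++ x) (L, 1, []))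
      (workCfg f γ e P σ x ((u.map f).reverse ++ L, 1, [])) := by
  induction u generalizing L with
  | nil => exact .refl _ _
  | cons a u ih =>
    have s1 : (bufferMachine f γ e P).ReachesLE 1
        (workCfg f γ e P σ ((a :: u).map some ++ x) (L, 1, []))
        (workCfg f γ e P σ (u.map some ++ x) (L, f a, [])) :=
      bufferCfg_step (.read _ (σ (f a)) a (by rw [hσ _ h1, hσ _ (hf a), one_mul])) rfl rfl
        (pop_rightTape_nil _ _) (act_none rfl)
    have s2 : (bufferMachine f γ e P).ReachesLE 1
        (workCfg f γ e P σ (u.map some ++ x) (L, f a, []))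
        (workCfg f γ e P σ (u.map some ++ x) (f a :: L, 1, [])) :=
      bufferCfg_step (.emitLeft _ (σ 1) (σ (f a)) _ (by rw [hσ _ h1, hσ _ (hf a), mul_one]))
        rfl rfl (act_none rfl) (push_leftTape _ _)
    have h := s1.trans (s2.trans (ih (f a :: L)))
    simp only [List.map_cons, List.reverse_cons, List.append_assoc, List.cons_append,
      List.nil_append] at h ⊢
    exact h.mono (by simp; omega)

theorem bufferCfg_drop (hP : P) (w L : List Γ) (y : List (Option A)) :
    (bufferMachine f γ e P).ReachesLE (2 * w.length)
      (bufferCfg f γ e P .drop (rightTape [] (none :: y)) (leftTape A (w ++ L)))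
      (bufferCfg f γ e P .drop (rightTape [] (none :: y)) (leftTape A L)) := by
  induction w with
  | nil => exact .refl _ _
  | cons g w ih =>
    have s1 := bufferCfg_step (f := f) (γ := γ) (e := e) (T₀ := rightTape [] (none :: y))
      (T₁ := leftTape A (g :: (w ++ L))) (.drop _ hP) rfl rfl (act_none rfl)
      (act_some (head_leftTape _) _)
    have s2 := bufferCfg_step (f := f) (γ := γ) (e := e) (P := P) (T₀ := rightTape [] (none :: y))
      (.dropping _ g) rfl (head_move_leftTape_cons g (w ++ L)) (act_none rfl) (pop_leftTape _ _)
    exact (s1.trans (s2.trans ih)).mono (by simp; omega)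

theorem bufferCfg_toEnd (T : Tape (Option (Option A ⊕ Γ))) (hT : T.head = none) (v w : List A) :
    (bufferMachine f γ e P).ReachesLE w.length
      (bufferCfg f γ e P .toEnd (inputTape Γ v (w.map some)) T)
      (bufferCfg f γ e P .toEnd (inputTape Γ (v ++ w) []) T) := by
  induction w generalizing v with
  | nil => simpa using NTM.ReachesLE.refl _ _
  | cons a w ih =>
    have s1 := bufferCfg_step (f := f) (γ := γ) (e := e) (P := P) (.toEnd a)
      (head_inputTape_cons v (some a) (w.map some)) hT
      ((act_some rfl _).trans (inputTape_move_right _ _ _)) (act_none hT)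
    have h := s1.trans (ih (v ++ [a]))
    rw [List.append_assoc] at h
    exact h.mono (by simp; omega)

/-- The part `y'` of the input to the right of the head has already been compared and plays no
further role, so its value is left unspecified. -/
theorem bufferCfg_compare {τ : A → Γ} (hτ : ∀ a, γ (τ a) = f a) (v : List A) (L : List Γ)
    (y : List (Option A)) :
    ∃ y', (bufferMachine f γ e P).ReachesLE v.length
      (bufferCfg f γ e P .compare ((inputTape Γ v y).move .left)
        ((leftTape A ((v.map τ).reverse ++ L)).move .left))
      (bufferCfg f γ e P .compare ((inputTape Γ [] y').move .left)
        ((leftTape A L).move .left)) := by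
  induction v using List.reverseRecOn generalizing y with
  | nil => exact ⟨y, .refl _ _⟩
  | append_singleton v a ih =>
    obtain ⟨y', h⟩ := ih (some a :: y)
    refine ⟨y', ?_⟩
    rw [inputTape_move_left, List.map_append, List.map_singleton, List.reverse_append,
      List.reverse_singleton, List.append_assoc, List.singleton_append]
    have s1 := bufferCfg_step (f := f) (γ := γ) (e := e) (P := P) (.compare a (τ a) (hτ a))
      (head_inputTape_cons v (some a) y)
      (head_move_leftTape_cons (τ a) ((v.map τ).reverse ++ L))
      (act_some (head_inputTape_cons v (some a) y) _)
      (pop_move_leftTape _ _)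
    exact (s1.trans h).mono (by simp; omega)

theorem bufferCfg_accept {τ : A → Γ} (hτ : ∀ a, γ (τ a) = f a) {b : Γ} (hb : γ b = 1)
    (w₁ : List Γ) (v : List A) (w₂ : List Γ) (hw₁ : P → w₁ = []) (hw₂ : ¬ P → w₂ = []) :
    ∃ T T', (bufferMachine f γ e P).ReachesLE (2 * w₂.length + 2 * v.length + 4)
      (bufferCfg f γ e P (.work b) (rightTape [] (none :: v.map some))
        (leftTape A (w₂ ++ ((v.map τ).reverse ++ w₁))))
      (bufferCfg f γ e P .done T T') := by
  have s1 := bufferCfg_step (f := f) (γ := γ) (e := e) (P := P) (.finish b hb)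
    (head_rightTape_nil_cons none (v.map some))
    (head_leftTape (A := A) (w₂ ++ ((v.map τ).reverse ++ w₁))) (act_none rfl) (act_none rfl)
  have s2 : (bufferMachine f γ e P).ReachesLE (2 * w₂.length)
      (bufferCfg f γ e P .drop (rightTape [] (none :: v.map some))
        (leftTape A (w₂ ++ ((v.map τ).reverse ++ w₁))))
      (bufferCfg f γ e P .drop (rightTape [] (none :: v.map some))
        (leftTape A ((v.map τ).reverse ++ w₁))) := by
    by_cases hP : P
    · exact bufferCfg_drop hP _ _ _
    · rw [hw₂ hP]
      exact .refl _ _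
  have s3 := bufferCfg_step (f := f) (γ := γ) (e := e) (P := P) (.advance _)
    (rfl : (rightTape ([] : List Γ) (none :: v.map some)).head = _)
    (head_leftTape (A := A) ((v.map τ).reverse ++ w₁))
    ((act_some rfl _).trans (rightTape_move_right _)) (act_none rfl)
  have s4 := bufferCfg_toEnd (f := f) (γ := γ) (e := e) (P := P)
    (leftTape A ((v.map τ).reverse ++ w₁)) rfl [] v
  have s5 := bufferCfg_step (f := f) (γ := γ) (e := e) (P := P) .turn (head_inputTape_nil v)
    (head_leftTape (A := A) ((v.map τ).reverse ++ w₁)) (act_some (head_inputTape_nil v) _)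
    (act_some (head_leftTape _) _)
  obtain ⟨y, s6⟩ := bufferCfg_compare (e := e) (P := P) hτ v w₁ []
  have s7 := bufferCfg_step (f := f) (γ := γ) (e := e)
    (T₁ := (leftTape A w₁).move .left)
    (.accept (P := P) _ (fun hP => by rw [hw₁ hP]; exact head_move_leftTape_nil))
    (head_inputTape_move_left y) rfl (act_none (head_inputTape_move_left y)) (act_none rfl)
  exact ⟨_, _, (s1.trans (s2.trans (s3.trans (s4.trans (s5.trans (s6.trans s7)))))).mono
    (by omega)⟩

/-- The buffer machine accepts `u # v` if `u` is transformed into `w₁ v w₂`. -/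
theorem bufferMachine_complete (hσ : ∀ m ∈ B, γ (σ m) = m) (h1 : (1 : M) ∈ B)
    (hf : ∀ a, f a ∈ B) (u v : List A) (w₁ w₂ : List M)
    (hw₁ : P → w₁ = []) (hw₂ : ¬ P → w₂ = []) {n : ℕ}
    (h : Moves B n ([], 1, u.map f) ((w₁ ++ v.map f ++ w₂).reverse, 1, [])) :
    ∃ m ≤ 6 * u.length + 2 * n + (2 * w₂.length + 2 * v.length + 4),
      (bufferMachine f γ (σ 1) P).AcceptsIn (u.map some ++ none :: v.map some) m := by
  have s1 := workCfg_read (e := σ 1) (P := P) (x := none :: v.map some) hσ h1 hf u []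
  -- Reading leaves `u` on the left stack, whereas the given moves start with it on the right one.
  -- Transferring it back takes `2 * u.length` moves, that is at most `4 * u.length` steps, besides
  -- the `2 * u.length` steps of reading.
  have h2 := (Moves.shift h1 (r := u.map f) (by simpa using fun a _ => hf a) [] []).symm
  rw [List.append_nil, List.append_nil] at h2
  rw [List.append_nil] at s1
  have s2 := workCfg_moves (f := f) (e := σ 1) (P := P) (x := none :: v.map some) hσ h2
  have s3 := workCfg_moves (f := f) (e := σ 1) (P := P) (x := none :: v.map some) hσ h
  obtain ⟨T, T', s4⟩ := bufferCfg_accept (e := σ 1) (P := P) (τ := fun a => σ (f a))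
    (fun a => hσ _ (hf a)) (hσ 1 h1) (w₁.map σ).reverse v (w₂.map σ).reverse
    (fun hP => by simp [hw₁ hP]) (fun hP => by simp [hw₂ hP])
  have e1 : workCfg f γ (σ 1) P σ (none :: v.map some) ((w₁ ++ v.map f ++ w₂).reverse, 1, []) =
      bufferCfg f γ (σ 1) P (.work (σ 1)) (rightTape [] (none :: v.map some))
        (leftTape A ((w₂.map σ).reverse ++
          ((v.map fun a => σ (f a)).reverse ++ (w₁.map σ).reverse))) := by
    simp [workCfg, Function.comp_def]
  rw [e1] at s3
  obtain ⟨m, hm, hr⟩ := s1.trans (s2.trans (s3.trans s4))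
  refine ⟨m, hm.trans ?_, _, hr, rfl⟩
  simp only [List.length_map, List.length_reverse]
  omega

end Completeness

/-! ### From moves and short witnesses to NP. -/

section Main

variable {A M : Type*} [Monoid M]

/-- A language of words `u # v` is in NP if it is defined by the existence of short words `w₁`
and `w₂`, not both of them nontrivial, such that `u` and `w₁ v w₂` represent the same element. -/
theorem inNP_of_moves [Finite A] {f : A → M} {P : Prop} {rel : M → M → Prop}
    (hrel : ∀ a b, rel a b ↔ ∃ y z : M, (P → y = 1) ∧ (¬ P → z = 1) ∧ y * b * z = a)
    {B X : Set M} (hB : B.Finite) (hXB : X ⊆ B) (h1 : (1 : M) ∈ B) (hf : ∀ a, f a ∈ X) {c k : ℕ}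
    (hmoves : ∀ u v : List M, (∀ s ∈ u, s ∈ X) → (∀ s ∈ v, s ∈ X) →
      u.prod = v.prod → Moves B (c * (u.length + v.length + 1) ^ 2) ([], 1, u) (v.reverse, 1, []))
    (hshort : ∀ u v : List A, rel (u.map f).prod (v.map f).prod → ∃ w₁ w₂ : List M,
      (P → w₁ = []) ∧ (¬ P → w₂ = []) ∧ (∀ s ∈ w₁, s ∈ X) ∧
      (∀ s ∈ w₂, s ∈ X) ∧ w₁.length + w₂.length ≤ k * (u.length + v.length + 1) ∧
      w₁.prod * (v.map f).prod * w₂.prod = (u.map f).prod) :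
    InNP (relLanguage f rel) := by
  -- The elements of `B` are coded by `Fin N`, because the work symbols and states have to form
  -- types in `Type` while `M` lies in an arbitrary universe. The code of an element outside `B` is
  -- irrelevant.
  obtain ⟨N, ⟨E⟩⟩ := finite_iff_exists_equiv_fin.1 hB.to_subtype
  let γ : Fin N → M := fun i => E.symm i
  let e : Fin N := E ⟨1, h1⟩
  classical
  let σ : M → Fin N := fun m => if h : m ∈ B then E ⟨m, h⟩ else e
  have hσ : ∀ m ∈ B, γ (σ m) = m := fun m hm => by simp [γ, σ, hm]
  refine ⟨bufferMachine f γ (σ 1) P,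
    -- The word `w₁ v w₂` has length linear in the input, with a constant controlled by `k`, so the
    -- quadratic number of moves gives the first summand, with two steps per move. The second pays
    -- for dropping `w₂`, the third for reading and comparing.
    Polynomial.C (2 * c * (k + 2) ^ 2 + 2 * k + 12) * (Polynomial.X + 1) ^ 2, ?_, ?_⟩
  · intro x n hx
    obtain ⟨u, v, hx, h⟩ := bufferMachine_sound (hσ 1 h1) hx
    exact ⟨u, v, hx, (hrel _ _).2 h⟩
  · rintro x ⟨u, v, rfl, h⟩
    obtain ⟨w₁, w₂, hw₁, hw₂, hs₁, hs₂, hl, he⟩ := hshort u v h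
    have hm := hmoves (u.map f) (w₁ ++ v.map f ++ w₂) (by simpa using fun a _ => hf a)
      (by
        intro s hs
        simp only [List.mem_append, List.mem_map] at hs
        rcases hs with (hs | ⟨a, -, rfl⟩) | hs
        exacts [hs₁ s hs, hf a, hs₂ s hs]) (by simp [← he, mul_assoc])
    obtain ⟨m, hle, hacc⟩ := bufferMachine_complete hσ h1 (fun a => hXB (hf a)) u v w₁ w₂ hw₁ hw₂ hm
    refine ⟨m, hle.trans ?_, hacc⟩
    simp only [List.length_map, List.length_append, List.length_cons, Polynomial.eval_mul,
      Polynomial.eval_C, Polynomial.eval_pow, Polynomial.eval_add, Polynomial.eval_X,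
      Polynomial.eval_one]
    generalize u.length = a at *
    generalize v.length = b at *
    have h3 : a + (w₁.length + b + w₂.length) + 1 ≤ (k + 2) * (a + (b + 1) + 1) := by nlinarith
    have h4 : c * (a + (w₁.length + b + w₂.length) + 1) ^ 2 ≤
        c * ((k + 2) * (a + (b + 1) + 1)) ^ 2 := by gcongr
    have h5 : w₂.length ≤ k * (a + b + 1) := by omega
    have h6 : k * (a + b + 1) ≤ k * (a + (b + 1) + 1) ^ 2 := by
      gcongr; nlinarith
    have h7 : 6 * a + 2 * b + 4 ≤ 12 * (a + (b + 1) + 1) ^ 2 := by nlinarith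
    rw [mul_pow] at h4
    linarith

theorem rOrder_iff {a b : M} : ROrder a b ↔ ∃ z, b * z = a := by
  constructor
  · intro h
    exact h ⟨1, mul_one a⟩
  · rintro ⟨z, rfl⟩ _ ⟨m, rfl⟩
    exact ⟨z * m, (mul_assoc _ _ _).symm⟩

theorem lOrder_iff {a b : M} : LOrder a b ↔ ∃ y, y * b = a := by
  constructor
  · intro h
    exact h ⟨1, one_mul a⟩
  · rintro ⟨z, rfl⟩ _ ⟨m, rfl⟩
    exact ⟨m * z, mul_assoc _ _ _⟩

theorem prod_map_mem_wordBall {S : Finset M} {f : A → M} {k : ℕ} (hf : ∀ a, f a ∈ wordBall S k)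
    (u : List A) : (u.map f).prod ∈ wordBall S (k * u.length) := by
  induction u with
  | nil => exact one_mem_wordBall _
  | cons a u ih =>
    rw [List.map_cons, List.prod_cons, List.length_cons, mul_add, mul_one, add_comm]
    exact mul_mem_wordBall (hf a) ih

end Main

end HypMonoid

theorem mainTheorem4 {M : Type*} [Monoid M] [IsLeftCancelMul M] (hfg : Monoid.FG M)
    (hdeg : HypMonoid.BoundedIndegree M) (hhyp : HypMonoid.StronglyHyperbolic M)
    {A : Type*} [Finite A] (f : A → M) (hf : Submonoid.closure (Set.range f) = ⊤) :
    HypMonoid.InNP (HypMonoid.relLanguage f (HypMonoid.LOrder (M := M))) ∧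
      HypMonoid.InNP (HypMonoid.relLanguage f (HypMonoid.ROrder (M := M))) := by
  open HypMonoid in
  obtain ⟨S, hS, δ, hδ⟩ := hhyp
  have hthin := thinWords_of_hyperbolic hδ
  obtain ⟨C, hlin⟩ := exists_linearSides hdeg hthin
  obtain ⟨k₀, hk₀⟩ := exists_wordBall hS (Set.finite_range f)
  -- The radius is made positive so that the ball contains `S` as well as the letters of `A`:
  -- witnesses are words over `S`.
  set k := k₀ + 1 with hk
  have hfk : ∀ a, f a ∈ wordBall S k := fun a => wordBall_mono (by omega) (hk₀ ⟨a, rfl⟩)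
  have hSk : ∀ s ∈ S, s ∈ wordBall S k := fun s hs => wordBall_mono (by omega) (mem_wordBall_one hs)
  obtain ⟨B, hB, hkB, c, hc⟩ := moves_of_prod_eq hS hthin hlin k
  have est : ∀ {n a b p r : ℕ}, n + 1 ≤ C * (p + r + 2) → p ≤ k * b → r ≤ k * a →
      n ≤ (C * (k + 2)) * (a + b + 1) := by
    intro n a b p r h hp hr
    have h1 : p + r + 2 ≤ (k + 2) * (a + b + 1) := by nlinarith
    have h2 := Nat.mul_le_mul_left C h1
    rw [mul_assoc]
    omega
  constructor
  -- For the `L`-order the witness is the first side of a triangle whose other sides represent `v`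
  -- and `u`; the machine may leave it unread at the bottom of the left stack.
  · refine inNP_of_moves (P := False) (k := C * (k + 2)) (fun a b => by simp [lOrder_iff]) hB hkB
      (hkB (one_mem_wordBall _)) hfk hc ?_
    intro u v h
    obtain ⟨y, hy⟩ := lOrder_iff.1 h
    obtain ⟨p, hp, rfl⟩ := exists_geodesicWord hS y
    obtain ⟨q, hq, hqv⟩ := exists_geodesicWord hS (v.map f).prod
    obtain ⟨r, hr, hru⟩ := exists_geodesicWord hS (u.map f).prod
    have h1 := (hlin p q r hp hq hr (by rw [hqv, hru, hy])).1
    have h2 := hq.length_le (by rw [hqv]; exact prod_map_mem_wordBall hfk v)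
    have h3 := hr.length_le (by rw [hru]; exact prod_map_mem_wordBall hfk u)
    exact ⟨p, [], False.elim, fun _ => rfl, fun s hs => hSk s (hp.1 s hs), by simp,
      est h1 h2 h3, by simpa using hy⟩
  -- For the `R`-order the witness is the second side; it lies on top of the left stack and is
  -- dropped before the comparison.
  · refine inNP_of_moves (P := True) (k := C * (k + 2)) (fun a b => by simp [rOrder_iff]) hB hkB
      (hkB (one_mem_wordBall _)) hfk hc ?_
    intro u v h
    obtain ⟨z, hz⟩ := rOrder_iff.1 h
    obtain ⟨p, hp, hpv⟩ := exists_geodesicWord hS (v.map f).prod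
    obtain ⟨q, hq, rfl⟩ := exists_geodesicWord hS z
    obtain ⟨r, hr, hru⟩ := exists_geodesicWord hS (u.map f).prod
    have h1 := (hlin p q r hp hq hr (by rw [hpv, hru, hz])).2
    have h2 := hp.length_le (by rw [hpv]; exact prod_map_mem_wordBall hfk v)
    have h3 := hr.length_le (by rw [hru]; exact prod_map_mem_wordBall hfk u)
    exact ⟨[], q, fun _ => rfl, fun h => (h trivial).elim, by simp,
      fun s hs => hSk s (hq.1 s hs), by simpa using est h1 h2 h3, by simpa using hz⟩
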